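/- Let $G=(V,E)$ be a finite simple graph with $n=|V|$ nodes and weights $w_{ij}>0$ on its edges, and fix a damping factor $\kappa\in(0,1)$. A message vector $\underline\alpha\in\mathbb{R}_{+}^{2|E|}$ has an entry $\alpha_{i\to j}\ge 0$ for each directed edge $i\to j$. With offers $m_{i\to j}=(w_{ij}-\alpha_{i\to j})_+-\tfrac12(w_{ij}-\alpha_{i\to j}-\alpha_{j\to i})_+$, the natural dynamics is $$\alpha^{t+1}_{i\to j}=\kappa\max_{k\in\partial i\setminus j}m^t_{k\to i}+(1-\kappa)\alpha^t_{i\to j}$$ (a maximum over the empty set is $0$), and the earnings at $\underline\alpha$ are $\gamma_i=\max_{k\in\partial i}m_{k\to i}$. **Solutions.** $(M,\underline\gamma)$ is a Nash bargaining solution if $M$ is a matching, $\gamma_i\ge0$, $\gamma_i=0$ for unmatched $i$, $\gamma_i+\gamma_j=w_{ij}$ on $M$, $\gamma_i+\gamma_j\ge w_{ij}$ on $E\setminus M$, and $\gamma_i-a_{i\setminus j}=\gamma_j-a_{j\setminus i}$ for $(i,j)\in M$, where $a_{i\setminus j}=\max_{k\in\partial i\setminus j}(w_{ik}-\gamma_k)_+$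 is the second-best offer to $i$. **KT sequence.** Let ${\cal C}_0$ be the set of nodes unmatched in $M$. A Kleinberg–Tardos (KT) sequence of $(M,\underline\gamma)$ consists of disjoint nonempty sets $V({\cal C}_1),\dots,V({\cal C}_k)$ of nodes, each closed under taking partners in $M$, which together with ${\cal C}_0$ partition $V$, and of slacks $\sigma_1,\dots,\sigma_k$, such that for every $q$, with $F={\cal C}_0\cup V({\cal C}_1)\cup\dots\cup V({\cal C}_{q-1})$: 1. $\sigma_q$ is the optimal value of the linear program: maximize $s$ over $(y,s)$ subject to $y=\gamma$ on $F$, $y_i+y_j=w_{ij}$ on $M$, $y_i\ge s$ for $i\notin F$, and $y_i+y_j-w_{ij}\ge s$ for edges outside $M$ that do not have both endpoints in $F$; and $\underline\gamma$ attains this optimum. 2. The second-best offer to each $i\in V({\cal C}_q)$ equals $\gamma_i-\sigma_q$. 3. Let $E({\cal C}_q)=E_1\cup E_2$, where $E_1$ consists of the matching edges at $V({\cal C}_q)$ and $E_2$ of the edges $(i,j)\notin M$ such that $i\in V({\cal C}_q)$ receives its second-best offer, which is positive, from $j$. All endpoints of $E({\cal C}_q)$, forming the set $V_{\rm ext}({\cal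 C}_q)$, lie in $V({\cal C}_q)\cup F$, and $E({\cal C}_q)$ is one of the following: an alternating path (whose two ends may coincide if they are a node of $F$); a blossom, i.e. an odd cycle, alternating except at one node where both cycle edges are unmatched, with an alternating stem whose first edge at that node is matched; a bicycle, i.e. two disjoint such odd cycles joined at their exceptional nodes by an alternating path with matched end edges; or an alternating cycle all of whose nodes have $\gamma_i>\sigma_q$. **Gap.** The solution has gap $\sigma$ if it has a KT sequence with $\sigma\le\min\{\sigma_1,\sigma_2-\sigma_1,\dots,\sigma_k-\sigma_{k-1}\}$ such that $\gamma_i+\gamma_j-w_{ij}\ge\sigma_q+\sigma$ for every $q\in\{1,\dots,k\}$ and every edge $(i,j)\notin E({\cal C}_q)$ with $i\in V({\cal C}_q)$ and $j\in V_{\rm ext}({\cal C}_q)$. **Theorem.** For each $\kappa\in(0,1)$ there is a constant $C<\infty$, independent of the instance, $n$, $\sigma$ and $\Delta$, such that the following holds. Suppose that the natural dynamics on $(G,w)$ has a unique fixed point $\underline\alpha^*\in\mathbb{R}_+^{2|E|}$, and that for some matching $M$ the pair $(M,\underline\gamma^*)$, with $\underline\gamma^*$ the earnings at $\underline\alpha^*$,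 is a Nash bargaining solution with gap $\sigma$. Let $U_G(\underline\alpha)=\|\underline\alpha-\underline\alpha^*\|_\infty$. Then for every initial condition $\underline\alpha^0\in\mathbb{R}_+^{2|E|}$ with $U_G(\underline\alpha^0)\le\Delta$ and all integers $t\ge C\,n^7$, $$U_G(\underline\alpha^t)\le\Delta-\min(\sigma,\Delta)/2 .$$ -/

import Mathlib

universe u

namespace ExchangeNetwork

section Dynamics

variable {V : Type u} (G : SimpleGraph V) (w : Sym2 V → ℝ)

/-- A message vector has one real entry `α d` for every directed edge `d = (i → j)` of `G`.
The offer along `i → j` is `(w_ij - α_{i→j})₊ - (1/2) (w_ij - α_{i→j} - α_{j→i})₊`. -/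
noncomputable def offer (α : G.Dart → ℝ) (d : G.Dart) : ℝ :=
  (w d.edge - α d)⁺ - (1 / 2) * (w d.edge - α d - α d.symm)⁺

/-- The earning estimate of `i`: the largest offer received by `i`
(`0` if `i` has no neighbours; all suprema here are over finite families). -/
noncomputable def earning (α : G.Dart → ℝ) (i : V) : ℝ :=
  ⨆ e : {e : G.Dart // e.snd = i}, offer G w α e

/-- One synchronous step of the natural dynamics with damping factor `κ`:
the new message `i → j` is `κ * max_{k ∈ ∂i \ j} m_{k→i} + (1 - κ) * α_{i→j}`
(a maximum over the empty set is `0`). -/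
noncomputable def step (κ : ℝ) (α : G.Dart → ℝ) (d : G.Dart) : ℝ :=
  κ * (⨆ e : {e : G.Dart // e.snd = d.fst ∧ e.fst ≠ d.snd}, offer G w α e) + (1 - κ) * α d

/-- The sup-norm distance of two message vectors (`0` if there are no edges). -/
noncomputable def supDist (α β : G.Dart → ℝ) : ℝ :=
  ⨆ d : G.Dart, |α d - β d|

end Dynamics

section Solutions

variable {V : Type u} {G : SimpleGraph V} (w : Sym2 V → ℝ) (M : G.Subgraph) (γ : V → ℝ)

/-- The best alternative of `i` to trading with `j`: `max_{k ∈ ∂i \ j} (w_ik - γ_k)₊`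
(`0` if `i` has no other neighbour). -/
noncomputable def alternative (G : SimpleGraph V) (w : Sym2 V → ℝ) (γ : V → ℝ) (i j : V) : ℝ :=
  ⨆ k : {k : V // G.Adj i k ∧ k ≠ j}, (w s(i, (k : V)) - γ k)⁺

/-- `(M, γ)` is a Nash bargaining solution (balanced outcome). -/
structure IsNBSolution : Prop where
  isMatching : M.IsMatching
  nonneg : ∀ i, 0 ≤ γ i
  unmatched : ∀ i, i ∉ M.verts → γ i = 0
  trade : ∀ i j, M.Adj i j → γ i + γ j = w s(i, j)
  stable : ∀ i j, G.Adj i j → ¬ M.Adj i j → w s(i, j) ≤ γ i + γ j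
  balanced : ∀ i j, M.Adj i j →
    γ i - alternative G w γ i j = γ j - alternative G w γ j i

/-- Feasibility of `(y, s)` for the linear program of one stage of the Kleinberg-Tardos procedure,
in which the nodes of `F` already have their values `γ`: all slacks of unmatched edges and of
nodes that are not yet settled are at least `s`. -/
structure IsLPFeasible (F : Set V) (y : V → ℝ) (s : ℝ) : Prop where
  settled : ∀ i ∈ F, y i = γ i
  trade : ∀ i j, M.Adj i j → y i + y j = w s(i, j)
  node_slack : ∀ i, i ∉ F → s ≤ y i
  edge_slack : ∀ i j, G.Adj i j → ¬ M.Adj i j → ¬ (i ∈ F ∧ j ∈ F) → s ≤ y i + y j - w s(i, j)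

/-- The matching edges along which the nodes of `C` trade. -/
def edges₁ (C : Set V) : Set (Sym2 V) :=
  {e | ∃ i ∈ C, ∃ j, M.Adj i j ∧ e = s(i, j)}

/-- The edges along which some node of `C` receives its second-best, positive offer
(the best one comes from its trading partner `p`). -/
def edges₂ (C : Set V) : Set (Sym2 V) :=
  {e | ∃ i ∈ C, ∃ p j, M.Adj i p ∧ G.Adj i j ∧ j ≠ p ∧ 0 < w s(i, j) - γ j ∧
    w s(i, j) - γ j = alternative G w γ i p ∧ e = s(i, j)}

/-- All edges of the structure with node set `C`. -/
def edges (C : Set V) : Set (Sym2 V) :=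
  edges₁ M C ∪ edges₂ w M γ C

/-- All endpoints of edges of the structure with node set `C`. -/
def extNodes (C : Set V) : Set V :=
  {i | ∃ e ∈ edges w M γ C, i ∈ e}

end Solutions

section Topologies

variable {V : Type u} {G : SimpleGraph V} (M : G.Subgraph)

/-- The edges `p 0 - p 1 - ⋯ - p ℓ`. -/
def seqEdges (p : ℕ → V) (ℓ : ℕ) : Set (Sym2 V) :=
  {e | ∃ i < ℓ, e = s(p i, p (i + 1))}

/-- `E` is an alternating path. An endpoint outside the node set `C` is an anchor, and both ends
of the path may be anchored at the same node; there are no other repetitions. -/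
def IsAlternatingPath (C : Set V) (E : Set (Sym2 V)) : Prop :=
  ∃ (ℓ : ℕ) (p : ℕ → V), 0 < ℓ ∧
    (∀ i j, i < j → j ≤ ℓ → p i = p j → i = 0 ∧ j = ℓ ∧ p 0 ∉ C) ∧
    (∀ i, i + 1 < ℓ → (M.Adj (p i) (p (i + 1)) ↔ ¬ M.Adj (p (i + 1)) (p (i + 2)))) ∧
    E = seqEdges p ℓ

/-- An alternating path `r 0 - ⋯ - r a` without repetitions whose edge at `r 0` is matched. -/
def IsStem (r : ℕ → V) (a : ℕ) : Prop :=
  0 < a ∧ Set.InjOn r (Set.Iic a) ∧ ∀ i < a, (M.Adj (r i) (r (i + 1)) ↔ Even i)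

/-- An odd cycle `c 0 - ⋯ - c b = c 0` alternating except at `c 0`, where both edges
are unmatched. -/
def IsOddCycle (c : ℕ → V) (b : ℕ) : Prop :=
  3 ≤ b ∧ Odd b ∧ c b = c 0 ∧ Set.InjOn c (Set.Iio b) ∧
    ∀ i < b, (M.Adj (c i) (c (i + 1)) ↔ Odd i)

/-- `E` is a blossom: an odd cycle with a stem attached to it. -/
def IsBlossom (E : Set (Sym2 V)) : Prop :=
  ∃ (a b : ℕ) (r c : ℕ → V), IsStem M r a ∧ IsOddCycle M c b ∧ c 0 = r 0 ∧
    (∀ i ≤ a, ∀ j < b, r i = c j → i = 0 ∧ j = 0) ∧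
    E = seqEdges r a ∪ seqEdges c b

/-- `E` is a bicycle: two disjoint odd cycles joined by an alternating path with matched
end edges. -/
def IsBicycle (E : Set (Sym2 V)) : Prop :=
  ∃ (a b b' : ℕ) (r c c' : ℕ → V), IsStem M r a ∧ Odd a ∧
    IsOddCycle M c b ∧ IsOddCycle M c' b' ∧ c 0 = r 0 ∧ c' 0 = r a ∧
    (∀ i ≤ a, ∀ j < b, r i = c j → i = 0 ∧ j = 0) ∧
    (∀ i ≤ a, ∀ j < b', r i = c' j → i = a ∧ j = 0) ∧
    (∀ i < b, ∀ j < b', c i ≠ c' j) ∧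
    E = seqEdges r a ∪ seqEdges c b ∪ seqEdges c' b'

/-- `E` is an alternating (even) cycle. -/
def IsAlternatingCycle (E : Set (Sym2 V)) : Prop :=
  ∃ (ℓ : ℕ) (p : ℕ → V), 4 ≤ ℓ ∧ Even ℓ ∧ p ℓ = p 0 ∧ Set.InjOn p (Set.Iio ℓ) ∧
    (∀ i < ℓ, (M.Adj (p i) (p (i + 1)) ↔ Even i)) ∧
    E = seqEdges p ℓ

end Topologies

section Gap

variable {V : Type u} {G : SimpleGraph V} (w : Sym2 V → ℝ) (M : G.Subgraph) (γ : V → ℝ)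

/-- One stage of the Kleinberg-Tardos procedure for the solution `(M, γ)`: the nodes of `F` are
already settled, `s` is the optimal value of the linear program, attained at `γ`, and `C` is the
node set of a structure of slack `s` of one of the four possible topologies. A cycle has no
anchors, in particular none of its nodes has slack `s` by itself. -/
structure IsKTStage (F C : Set V) (s : ℝ) : Prop where
  feasible : IsLPFeasible w M γ F γ s
  optimal : ∀ y s', IsLPFeasible w M γ F y s' → s' ≤ s
  nonempty : C.Nonempty
  unsettled : Disjoint C F
  trade_closed : ∀ i j, M.Adj i j → i ∈ C → j ∈ C
  slack : ∀ i ∈ C, ∀ p, M.Adj i p → γ i - alternative G w γ i p = s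
  anchors : extNodes w M γ C ⊆ C ∪ F
  topology : IsAlternatingPath M C (edges w M γ C) ∨ IsBlossom M (edges w M γ C) ∨
    IsBicycle M (edges w M γ C) ∨
    (IsAlternatingCycle M (edges w M γ C) ∧ ∀ i ∈ C, s < γ i)

/-- The nodes settled before stage `q`: the unmatched ones and those of `C 0, …, C (q - 1)`. -/
def settledBefore (C : ℕ → Set V) (q : ℕ) : Set V :=
  M.vertsᶜ ∪ ⋃ p < q, C p

/-- `C 0, …, C (k - 1)` with slacks `s 0, …, s (k - 1)` is a Kleinberg-Tardos sequence of
`(M, γ)` (the set of unmatched nodes, which comes first, is not counted here). -/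
def IsKTSequence (k : ℕ) (C : ℕ → Set V) (s : ℕ → ℝ) : Prop :=
  (∀ q < k, IsKTStage w M γ (settledBefore M C q) (C q) (s q)) ∧
    settledBefore M C k = Set.univ

/-- `(M, γ)` has gap `σ`. -/
def HasGap (σ : ℝ) : Prop :=
  ∃ (k : ℕ) (C : ℕ → Set V) (s : ℕ → ℝ), IsKTSequence w M γ k C s ∧
    (0 < k → σ ≤ s 0) ∧
    (∀ q, q + 1 < k → σ ≤ s (q + 1) - s q) ∧
    ∀ q < k, ∀ i ∈ C q, ∀ j ∈ extNodes w M γ (C q), G.Adj i j → s(i, j) ∉ edges w M γ (C q) →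
      s q + σ ≤ γ i + γ j - w s(i, j)

end Gap

end ExchangeNetwork

open ExchangeNetwork

namespace ExchangeNetwork

/-! ### Averaged nonexpansive maps: asymptotic regularity and transfer of progress -/

section Averaged

/-! The dynamics is the averaged map κ S + (1 - κ) id, where S (`bestOffer`) sends messages to best
offers and is nonexpansive in the sup norm. Averaging makes the residual ‖S α - α‖ along the orbit
decay like Δ / √t (`asymptotic_regularity`). So it is enough to bound the distance to the fixed
point by the residual, near the fixed point.

This error bound is `IsNear.dev_le_of_approx`: if Δ ≤ σ/2 and the residual is η, the distance is at
most 28 n³ η. The gap freezes the combinatorics: partners make the best offers, and offers that are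
neither in the current structure nor from settled nodes stay irrelevant. Let x i be the deviation of
the message from i to its partner. Along an alternating path, half the differences of x across
matching edges then form a nearly harmonic sequence, so truncating their absolute values below at
the influence ε of the settled nodes gives a nearly subharmonic one. It is damped at both ends: an
end without unmatched structure edges inside the node set absorbs, and an odd cycle returns its
input with a sign conflict, which costs a factor 1 - 1/n. Hence each Kleinberg–Tardos stage adds
O(n² η) to the error (`IsSpine.bound`, `IsEndCycle.endDamped`), and there are at most n stages. An
even alternating cycle would have no damping, but it would carry a second fixed point, against
uniqueness (`IsGapStage.not_isAlternatingCycle`).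

Combining the two rates, the distance is halved in time O(n⁶) once it is at most σ/2 (`halving`).
Nonexpansiveness transfers absolute progress from a small ball to any larger one (`progress_of_le`),
which covers all Δ. -/

theorem iterate_nonexpansive {E : Type*} [NormedAddCommGroup E] {T : E → E}
    (hT : ∀ x y, ‖T x - T y‖ ≤ ‖x - y‖) (t : ℕ) (x y : E) :
    ‖T^[t] x - T^[t] y‖ ≤ ‖x - y‖ := by
  induction t with
  | zero => simp
  | succ t ih => simp only [Function.iterate_succ_apply']; exact (hT _ _).trans ih

/-- The averaged map `κ S + (1 - κ) id`. -/
def averaged {E : Type*} [AddCommGroup E] [Module ℝ E] (κ : ℝ) (S : E → E) (x : E) : E :=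
  κ • S x + (1 - κ) • x

theorem averaged_fixed {E : Type*} [AddCommGroup E] [Module ℝ E] {κ : ℝ} {S : E → E} {z : E}
    (hz : S z = z) : averaged κ S z = z := by
  simp only [averaged, hz, ← add_smul]; simp

variable {E : Type*} [NormedAddCommGroup E] [NormedSpace ℝ E]

theorem averaged_nonexpansive {κ : ℝ} (h0 : 0 ≤ κ) (h1 : κ ≤ 1) {S : E → E}
    (hS : ∀ x y, ‖S x - S y‖ ≤ ‖x - y‖) (x y : E) :
    ‖averaged κ S x - averaged κ S y‖ ≤ ‖x - y‖ := by
  have : averaged κ S x - averaged κ S y = κ • (S x - S y) + (1 - κ) • (x - y) := by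
    simp only [averaged, smul_sub]; abel
  rw [this]
  refine (norm_add_le _ _).trans ?_
  rw [norm_smul, norm_smul, Real.norm_of_nonneg h0, Real.norm_of_nonneg (by linarith : 0 ≤ 1 - κ)]
  nlinarith [hS x y]

/-- A race between two walkers: a family of nonnegative numbers that satisfies the two-state
averaging recursion and is bounded by `B` is of order `B / H` at time `N ≥ H ^ 2 κ / (1 - κ)`. -/
theorem race_bound {κ H B : ℝ} (h0 : 0 < κ) (h1 : κ < 1) (hB : 0 ≤ B) (hH1 : 1 ≤ H)
    (hH : 1 / κ ≤ H) {N : ℕ} (hN : H ^ 2 * κ ≤ (1 - κ) * N) (D F : ℕ → ℕ → ℝ)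
    (hD0 : ∀ m, D m m = 0) (hFB : ∀ m g, F m (m + g) ≤ B)
    (hD : ∀ m g, D m (m + g + 1) ≤ (1 - κ) * D m (m + g) + κ * F m (m + g))
    (hF : ∀ m g, F (m + 1) (m + g + 1) ≤
      (1 - κ) * F m (m + g + 1) + κ * D m (m + g + 1)) :
    F N N ≤ 4 * B / (κ * H) := by
  have hHpos : 0 < H := by linarith
  set ν : ℝ := 1 / κ with hν
  have hκν : κ * ν = 1 := by rw [hν]; field_simp
  have hν1 : 1 ≤ ν := by
    by_contra hc
    push Not at hc
    nlinarith
  set β : ℝ := B / H ^ 2 with hβ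
  have hβ0 : 0 ≤ β := by positivity
  have hβH : β * H ^ 2 = B := by rw [hβ]; field_simp
  set τ : ℝ := β * (ν - 1) with hτ
  have hτ0 : 0 ≤ τ := mul_nonneg hβ0 (by linarith)
  have hτN : B ≤ τ * N := by
    have : H ^ 2 ≤ (ν - 1) * N := by
      have h3 : ν * (H ^ 2 * κ) ≤ ν * ((1 - κ) * N) :=
        mul_le_mul_of_nonneg_left hN (by linarith)
      have e1 : ν * (H ^ 2 * κ) = H ^ 2 := by linear_combination H ^ 2 * hκν
      have e2 : ν * ((1 - κ) * N) = (ν - 1) * N := by linear_combination (-(N : ℝ)) * hκν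
      linarith
    calc B = β * H ^ 2 := hβH.symm
      _ ≤ β * ((ν - 1) * N) := mul_le_mul_of_nonneg_left this hβ0
      _ = τ * N := by rw [hτ]; ring
  have hquad : ∀ y : ℝ, 0 ≤ y → y ≤ 3 * H → 0 ≤ β * (4 * H * y - y ^ 2) := by
    intro y hy hy'
    apply mul_nonneg hβ0
    nlinarith
  have hbig : ∀ y : ℝ, H ≤ y → y ≤ 3 * H → B ≤ β * (4 * H * y - y ^ 2) := by
    intro y hy hy'
    rw [← hβH]
    apply mul_le_mul_of_nonneg_left _ hβ0
    nlinarith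
  -- A supersolution: the concave parabola β (4 H y - y²) is read at y = g for D and at y = g + 1/κ
  -- for F. With this shift both recursions preserve linear functions of y. The quadratic term
  -- leaves a slack τ in the recursion for D and costs τ in that for F, which the term τ (N - m)
  -- pays. The bound B is dominated at m = 0 by τ N, and at gaps near 2 H by the parabola. Both
  -- recursions decrease 2 m + g.
  have key : ∀ l m g : ℕ, 2 * m + g = l → m ≤ N → (g : ℝ) ≤ 2 * H →
      D m (m + g) ≤ β * (4 * H * g - (g : ℝ) ^ 2) + τ * (N - m) ∧
      F m (m + g) ≤ β * (4 * H * (g + ν) - ((g : ℝ) + ν) ^ 2) + τ * (N - m) := by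
    intro l
    induction l using Nat.strong_induction_on with
    | _ l ih =>
      intro m g hl hm hg
      have hmN : (0 : ℝ) ≤ N - m := by
        have : (m : ℝ) ≤ N := by exact_mod_cast hm
        linarith
      have hτm : 0 ≤ τ * (N - m) := mul_nonneg hτ0 hmN
      have hg0 : (0 : ℝ) ≤ g := Nat.cast_nonneg g
      constructor
      · rcases g with _ | g
        · simp only [add_zero, hD0]
          simpa using hτm
        · obtain ⟨hDg, hFg⟩ := ih (2 * m + g) (by omega) m g rfl hm (by push_cast at hg; linarith)
          refine (hD m g).trans ?_
          have e1 := mul_le_mul_of_nonneg_left hDg (by linarith : 0 ≤ 1 - κ)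
          have e2 := mul_le_mul_of_nonneg_left hFg h0.le
          refine (add_le_add e1 e2).trans ?_
          push_cast
          have e3 : β * (4 * H * (g + 1) - ((g : ℝ) + 1) ^ 2) + τ * (N - m)
            - ((1 - κ) * (β * (4 * H * g - (g : ℝ) ^ 2) + τ * (N - m)) +
              κ * (β * (4 * H * (g + ν) - ((g : ℝ) + ν) ^ 2) + τ * (N - m))) = τ := by
            rw [hτ]
            linear_combination β * (-4 * H + 2 * g + ν) * hκν
          linarith
      · rcases m with _ | m
        · refine (hFB 0 g).trans ?_
          have := hquad (g + ν) (by linarith) (by linarith)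
          simp only [Nat.cast_zero, sub_zero]
          linarith
        · by_cases hgH : (g : ℝ) + 1 ≤ 2 * H
          · obtain ⟨hDg, hFg⟩ := ih (2 * m + (g + 1)) (by omega) m (g + 1) rfl (by omega)
              (by push_cast; linarith)
            have h := hF m g
            rw [show m + 1 + g = m + g + 1 by omega]
            rw [← add_assoc] at hDg hFg
            refine h.trans ?_
            have e1 := mul_le_mul_of_nonneg_left hFg (by linarith : 0 ≤ 1 - κ)
            have e2 := mul_le_mul_of_nonneg_left hDg h0.le
            refine (add_le_add e1 e2).trans ?_
            push_cast
            have e3 : β * (4 * H * (g + ν) - ((g : ℝ) + ν) ^ 2) + τ * (N - (m + 1)) -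
                ((1 - κ) * (β * (4 * H * (g + 1 + ν) - ((g : ℝ) + 1 + ν) ^ 2) + τ * (N - m)) +
                κ * (β * (4 * H * (g + 1) - ((g : ℝ) + 1) ^ 2) + τ * (N - m))) = 0 := by
              rw [hτ]
              linear_combination β * (4 * H - 2 * (g + 1) - ν) * hκν
            linarith
          · have := hbig (g + ν) (by linarith) (by linarith)
            exact (hFB (m + 1) g).trans (by linarith)
  have h := (key (2 * N + 0) N 0 rfl le_rfl (by simp; linarith)).2
  simp only [add_zero, Nat.cast_zero, zero_add, sub_self, mul_zero] at h
  refine h.trans ?_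
  have : 4 * B / (κ * H) = β * (4 * H * ν) := by
    rw [hβ, hν]; field_simp
  rw [this]
  apply mul_le_mul_of_nonneg_left _ hβ0
  nlinarith

/-- Asymptotic regularity of averaged nonexpansive maps, with the rate `t ^ (-1/2)`. -/
theorem asymptotic_regularity {κ H Δ : ℝ} (h0 : 0 < κ) (h1 : κ < 1) {S : E → E}
    (hS : ∀ x y, ‖S x - S y‖ ≤ ‖x - y‖) {z : E} (hz : S z = z) {x : E} (hx : ‖x - z‖ ≤ Δ)
    (hH1 : 1 ≤ H) (hH : 1 / κ ≤ H) {t : ℕ} (ht : H ^ 2 * κ ≤ (1 - κ) * t) :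
    ‖S ((averaged κ S)^[t] x) - (averaged κ S)^[t] x‖ ≤ 8 * Δ / (κ * H) := by
  set T := averaged κ S with hT
  have hTz : ∀ t, T^[t] z = z := fun t => Function.iterate_fixed (averaged_fixed hz) t
  have hball : ∀ t, ‖T^[t] x - z‖ ≤ Δ := by
    intro t
    have := iterate_nonexpansive (averaged_nonexpansive h0.le h1.le hS) t x z
    rw [← hT, hTz] at this
    exact this.trans hx
  have hballS : ∀ t, ‖S (T^[t] x) - z‖ ≤ Δ := by
    intro t
    have := hS (T^[t] x) z
    rw [hz] at this
    exact this.trans (hball t)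
  have hΔ : 0 ≤ Δ := (norm_nonneg _).trans hx
  have tri : ∀ a b : E, ‖a - z‖ ≤ Δ → ‖b - z‖ ≤ Δ → ‖a - b‖ ≤ 2 * Δ := by
    intro a b ha hb
    have : a - b = (a - z) - (b - z) := by abel
    rw [this]
    exact (norm_sub_le _ _).trans (by linarith)
  have hsucc : ∀ m, T^[m + 1] x = κ • S (T^[m] x) + (1 - κ) • T^[m] x := by
    intro m
    rw [Function.iterate_succ_apply', hT, averaged]
  have conv : ∀ a b c : E, ‖κ • a + (1 - κ) • b - c‖ ≤ (1 - κ) * ‖b - c‖ + κ * ‖a - c‖ := by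
    intro a b c
    have : κ • a + (1 - κ) • b - c = (1 - κ) • (b - c) + κ • (a - c) := by
      simp only [smul_sub, sub_smul, one_smul]; abel
    rw [this]
    refine (norm_add_le _ _).trans ?_
    rw [norm_smul, norm_smul, Real.norm_of_nonneg h0.le,
      Real.norm_of_nonneg (by linarith : 0 ≤ 1 - κ)]
  -- D compares the iterates m and n; F compares S of iterate n with iterate m. Expanding the later
  -- iterate gives the recursion for D, expanding the earlier one that for F, where ‖S a - S b‖ ≤ ‖a
  -- - b‖ closes the system.
  have := race_bound (N := t) h0 h1 (B := 2 * Δ) (by linarith) hH1 hH ht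
    (fun m n => ‖T^[n] x - T^[m] x‖) (fun m n => ‖S (T^[n] x) - T^[m] x‖)
    (fun m => by simp)
    (fun m g => tri _ _ (hballS _) (hball _))
    (fun m g => by
      simp only [hsucc]
      exact conv _ _ _)
    (fun m g => by
      rw [norm_sub_rev, hsucc m, norm_sub_rev (S _) (T^[m] x)]
      refine (conv _ _ _).trans ?_
      gcongr
      rw [norm_sub_rev]
      exact hS _ _)
  refine this.trans (le_of_eq ?_)
  ring

/-- For a nonexpansive map, progress towards a fixed point from distance `r` gives the same
absolute progress from any larger distance. -/
theorem progress_of_le {T : E → E} (hT : ∀ x y, ‖T x - T y‖ ≤ ‖x - y‖) {z : E} {A : Set E}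
    (hA : Convex ℝ A) (hzA : z ∈ A) {r r' : ℝ} (hr : 0 ≤ r) {t : ℕ}
    (h : ∀ x ∈ A, ‖x - z‖ ≤ r → ‖T^[t] x - z‖ ≤ r') {Δ : ℝ} (hΔ : r ≤ Δ) {x : E} (hxA : x ∈ A)
    (hx : ‖x - z‖ ≤ Δ) : ‖T^[t] x - z‖ ≤ Δ - r + r' := by
  rcases hr.eq_or_lt with h0 | hr
  · have hz := h z hzA (by simp [hr])
    have h2 := iterate_nonexpansive hT t x z
    have : T^[t] x - z = (T^[t] x - T^[t] z) + (T^[t] z - z) := by abel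
    rw [this]
    exact (norm_add_le _ _).trans (by linarith)
  have hΔ0 : 0 < Δ := by linarith
  -- Split the way from x to z at y: the part from y to z has length at most r and makes the assumed
  -- progress, while the part from x to y, of length at most Δ - r, does not grow.
  set y : E := (1 - r / Δ) • z + (r / Δ) • x with hy
  have hq : r / Δ ≤ 1 := (div_le_one hΔ0).2 hΔ
  have hq0 : 0 ≤ r / Δ := by positivity
  have hyA : y ∈ A := hA hzA hxA (by linarith) hq0 (by ring)
  have hyz : y - z = (r / Δ) • (x - z) := by
    rw [hy]; simp only [smul_sub, sub_smul, one_smul]; abel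
  have hxy : x - y = (1 - r / Δ) • (x - z) := by
    rw [hy]; simp only [smul_sub, sub_smul, one_smul]; abel
  have h1 : ‖y - z‖ ≤ r := by
    rw [hyz, norm_smul, Real.norm_of_nonneg hq0]
    calc r / Δ * ‖x - z‖ ≤ r / Δ * Δ := by gcongr
      _ = r := by field_simp
  have h2 : ‖x - y‖ ≤ Δ - r := by
    rw [hxy, norm_smul, Real.norm_of_nonneg (by linarith)]
    calc (1 - r / Δ) * ‖x - z‖ ≤ (1 - r / Δ) * Δ := by
          apply mul_le_mul_of_nonneg_left hx; linarith
      _ = Δ - r := by field_simp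
  have h3 := iterate_nonexpansive hT t x y
  have h4 := h y hyA h1
  have : T^[t] x - z = (T^[t] x - T^[t] y) + (T^[t] y - z) := by abel
  rw [this]
  exact (norm_add_le _ _).trans (by linarith)

end Averaged

/-! ### Nearly subharmonic sequences -/

section Sequences

/-- A sequence that is subharmonic up to `s` between `0` and `L + 1`. -/
def Subharmonic (g : ℕ → ℝ) (L : ℕ) (s : ℝ) : Prop :=
  ∀ i < L, g (i + 1) ≤ (g i + g (i + 2)) / 2 + s

/-- Near convexity: after division by i + 1, the value at i lies below the chord from 0 to i + 1, up
to the error s i. The induction adds 2 (i + 1) times the local inequality to the preceding chord. -/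
theorem Subharmonic.left_chord {g : ℕ → ℝ} {L : ℕ} {s : ℝ} (h : Subharmonic g L s) :
    ∀ i ≤ L, ((i : ℝ) + 1) * g i ≤ i * g (i + 1) + g 0 + s * (i * (i + 1)) := by
  intro i
  induction i with
  | zero => simp
  | succ i ih =>
    intro hi
    have h1 := ih (by omega)
    have h2 := h i (by omega)
    have h3 := mul_le_mul_of_nonneg_left h2 (by positivity : (0 : ℝ) ≤ 2 * (i + 1))
    push_cast
    linarith

theorem Subharmonic.reverse {g : ℕ → ℝ} {L : ℕ} {s : ℝ} (h : Subharmonic g L s) :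
    Subharmonic (fun i => g (L + 1 - i)) L s := by
  intro i hi
  have := h (L - 1 - i) (by omega)
  simp only
  rw [show L - 1 - i + 1 = L + 1 - (i + 1) by omega, show L - 1 - i + 2 = L + 1 - i by omega,
    show L - 1 - i = L + 1 - (i + 2) by omega] at this
  linarith

theorem Subharmonic.last {g : ℕ → ℝ} {L : ℕ} {s : ℝ} (h : Subharmonic g L s) :
    ((L : ℝ) + 1) * g L ≤ L * g (L + 1) + g 0 + s * (L * (L + 1)) := h.left_chord L le_rfl

theorem Subharmonic.first {g : ℕ → ℝ} {L : ℕ} {s : ℝ} (h : Subharmonic g L s) :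
    ((L : ℝ) + 1) * g 1 ≤ L * g 0 + g (L + 1) + s * (L * (L + 1)) := by
  have := h.reverse.last
  simpa using this

theorem Subharmonic.le_of_ends {g : ℕ → ℝ} {L : ℕ} {s c : ℝ} (h : Subharmonic g L s)
    (h0 : g 0 ≤ c) (h1 : g (L + 1) ≤ c) (hs : 0 ≤ s) : ∀ i ≤ L + 1, g i ≤ c + s * L ^ 2 := by
  -- The barrier s (L + 1 - j) j vanishes at both ends and exceeds the mean of its neighbours by
  -- exactly s; the induction moves leftwards from the right end.
  have main : ∀ j ≤ L + 1, g (L + 1 - j) ≤ c + s * ((L + 1 - j : ℝ) * j) := by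
    intro j
    induction j with
    | zero => intro _; simpa using h1
    | succ j ih =>
      intro hj
      have h2 := ih (by omega)
      have h3 := h.left_chord (L + 1 - (j + 1)) (by omega)
      obtain ⟨i, hi⟩ : ∃ i, L = i + j := ⟨L - j, by omega⟩
      subst hi
      rw [show i + j + 1 - (j + 1) = i by omega] at h3 ⊢
      rw [show i + j + 1 - j = i + 1 by omega] at h2
      push_cast at h2 ⊢
      have h4 := mul_le_mul_of_nonneg_left h2 (by positivity : (0 : ℝ) ≤ i)
      have h5 : ((i : ℝ) + 1) * g i ≤ (i + 1) * (c + s * (i * (j + 1))) := by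
        linarith
      have h6 := le_of_mul_le_mul_left h5 (by positivity)
      linarith
  intro i hi
  have h2 := main (L + 1 - i) (by omega)
  rw [show L + 1 - (L + 1 - i) = i by omega] at h2
  refine h2.trans ?_
  have h3 : ((L + 1 - i : ℕ) : ℝ) = L + 1 - i := by
    rw [Nat.cast_sub hi]; push_cast; ring
  rw [h3]
  have h4 : ((L : ℝ) + 1 - (L + 1 - i)) * (L + 1 - i) ≤ L ^ 2 := by
    rcases Nat.eq_zero_or_pos i with rfl | hp
    · simp
    rcases hi.eq_or_lt with rfl | hi
    · push_cast; ring_nf; positivity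
    · have e1 : (1 : ℝ) ≤ i := by exact_mod_cast hp
      have e2 : (i : ℝ) ≤ L := by exact_mod_cast (by omega : i ≤ L)
      nlinarith
  have := mul_le_mul_of_nonneg_left h4 hs
  linarith

theorem Subharmonic.slopes {g : ℕ → ℝ} {L : ℕ} {s : ℝ} (h : Subharmonic g L s) :
    g 1 - g 0 ≤ g (L + 1) - g L + 2 * L * s := by
  have : ∀ i ≤ L, g 1 - g 0 ≤ g (i + 1) - g i + 2 * i * s := by
    intro i
    induction i with
    | zero => simp
    | succ i ih =>
      intro hi
      have h1 := ih (by omega)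
      have h2 := h i (by omega)
      push_cast
      linarith
  exact this L le_rfl

/-- A subharmonic sequence that shrinks by a factor `1 - 1/n` towards both ends is small. -/
theorem Subharmonic.bound {g : ℕ → ℝ} {L : ℕ} {s ε n : ℝ} (h : Subharmonic g L s) (hs : 0 ≤ s)
    (hn : 1 ≤ n) (hL : 0 < L) (hLn : (L : ℝ) ≤ n) (hg : ∀ i ≤ L + 1, ε ≤ g i)
    (h0 : g 0 - ε ≤ (1 - 1 / n) * (g 1 - ε) + 2 * n * s)
    (h1 : g (L + 1) - ε ≤ (1 - 1 / n) * (g L - ε) + 2 * n * s) :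
    ∀ i ≤ L + 1, g i ≤ ε + 9 * n ^ 2 * s := by
  have hsl := h.slopes
  have hn0 : 0 < n := by linarith
  have e1 := hg 1 (by omega)
  have e2 := hg L (by omega)
  have hLs : (L : ℝ) * s ≤ n * s := by gcongr
  -- Up to 2 n s, damping makes the first slope at least (g 1 - ε) / n and the last one at most -(g
  -- L - ε) / n, while near convexity makes slopes almost increasing.
  have h2 : 1 / n * ((g 1 - ε) + (g L - ε)) ≤ 6 * n * s := by linarith
  have h3 : (g 1 - ε) + (g L - ε) ≤ 6 * n ^ 2 * s := by
    have := mul_le_mul_of_nonneg_left h2 hn0.le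
    have e : n * (1 / n * ((g 1 - ε) + (g L - ε))) = (g 1 - ε) + (g L - ε) := by field_simp
    rw [e] at this
    linarith
  have hnn : n * s ≤ n ^ 2 * s := by
    apply mul_le_mul_of_nonneg_right _ hs
    nlinarith
  have hi : 0 ≤ 1 / n := by positivity
  have h4 : g 0 ≤ ε + 8 * n ^ 2 * s := by nlinarith
  have h5 : g (L + 1) ≤ ε + 8 * n ^ 2 * s := by nlinarith
  intro i hi
  refine (h.le_of_ends h4 h5 hs i hi).trans ?_
  have : (L : ℝ) ^ 2 ≤ n ^ 2 := by gcongr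
  have := mul_le_mul_of_nonneg_left this hs
  linarith

/-- The sequence `a, u 0, …, u (L - 1), b`. -/
def withEnds (a : ℝ) (u : ℕ → ℝ) (b : ℝ) (L : ℕ) : ℕ → ℝ
  | 0 => a
  | i + 1 => if i < L then u i else b

theorem withEnds_subharmonic {a b s : ℝ} {u : ℕ → ℝ} {L : ℕ} (hL : 0 < L)
    (P Q : ℕ → ℝ) (hu : ∀ i < L, u i ≤ (P i + Q i) / 2) (hP0 : P 0 ≤ a) (hQL : Q (L - 1) ≤ b)
    (hs : 0 ≤ s) (hP : ∀ i, i + 1 < L → P (i + 1) ≤ u i + s)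
    (hQ : ∀ i, i + 1 < L → Q i ≤ u (i + 1) + s) : Subharmonic (withEnds a u b L) L s := by
  intro i hi
  have h1 := hu i hi
  have hPi : P i ≤ withEnds a u b L i + s := by
    rcases i with _ | i
    · simp only [withEnds]; linarith
    · simp only [withEnds, if_pos (show i < L by omega)]; exact hP i hi
  have hQi : Q i ≤ withEnds a u b L (i + 2) + s := by
    rcases Nat.lt_or_ge (i + 1) L with h | h
    · simp only [withEnds, if_pos h]; exact hQ i h
    · simp only [withEnds, if_neg (not_lt.2 h)]
      rw [show L - 1 = i by omega] at hQL; linarith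
  have : withEnds a u b L (i + 1) = u i := by simp only [withEnds, if_pos hi]
  rw [this]
  linarith

end Sequences

/-! ### Static relations on spines and odd cycles -/

section Static

variable {V : Type u} {G : SimpleGraph V}

/-- `E` contains the matching edges of the node set `C`, and no other matching edges;
`C` consists of matched nodes and is closed under taking partners. -/
structure IsFrame (M : G.Subgraph) (C : Set V) (E : Set (Sym2 V)) : Prop where
  isMatching : M.IsMatching
  exists_partner : ∀ i ∈ C, ∃ p, M.Adj i p
  closed : ∀ i j, M.Adj i j → i ∈ C → j ∈ C
  edge_mem : ∀ i j, M.Adj i j → i ∈ C → s(i, j) ∈ E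
  mem_of_edge : ∀ i j, s(i, j) ∈ E → M.Adj i j → i ∈ C

/-- The approximate fixed point relations of the node variables `x` on the structure `(C, E)`,
where nodes outside of `C` have influence at most `ε`. -/
structure IsStatic (M : G.Subgraph) (C : Set V) (E : Set (Sym2 V)) (x : V → ℝ) (ε s : ℝ) :
    Prop where
  lower : ∀ i ∈ C, ∀ k ∈ C, ∀ p, s(i, k) ∈ E → ¬ M.Adj i k → M.Adj k p →
    (x p - x k) / 2 - s ≤ x i
  upper : ∀ i ∈ C, x i ≤ ε + s ∨
    ∃ k ∈ C, ∃ p, s(i, k) ∈ E ∧ ¬ M.Adj i k ∧ M.Adj k p ∧ x i ≤ (x p - x k) / 2 + s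
  bottom : ∀ i ∈ C, (∀ k ∈ C, s(i, k) ∈ E → M.Adj i k) → -ε - s ≤ x i

/-- The path `r 0 - ⋯ - r (2 * L - 1)` in `E` alternates, starts and ends with a matching edge, and
its inner nodes have no further neighbours in `E`. -/
structure IsSpine (M : G.Subgraph) (E : Set (Sym2 V)) (r : ℕ → V) (L : ℕ) : Prop where
  pos : 0 < L
  edge : ∀ j, j + 1 < 2 * L → s(r j, r (j + 1)) ∈ E
  alt : ∀ j, j + 1 < 2 * L → (M.Adj (r j) (r (j + 1)) ↔ Even j)
  nbr : ∀ j, 0 < j → j + 1 < 2 * L → ∀ k, s(r j, k) ∈ E → k = r (j - 1) ∨ k = r (j + 1)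

/-- The damping relation at the end `e` (with partner `e'`) of a spine. -/
def EndDamped (x : V → ℝ) (ε s n : ℝ) (e e' : V) : Prop :=
  max ε |x e| - ε ≤ (1 - 1 / n) * (max ε |(x e - x e') / 2| - ε) + 2 * n * s

variable {M : G.Subgraph} {C : Set V} {E : Set (Sym2 V)} {x : V → ℝ} {ε s n : ℝ}
  {r : ℕ → V} {L : ℕ}

/-- With a single unmatched neighbour in `E`, the maximum defining x i has only one term besides the
influence of the settled nodes. -/
theorem IsStatic.bounds (h : IsStatic M C E x ε s) (hF : IsFrame M C E) {i k p : V} (hi : i ∈ C)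
    (hk : k ∈ C) (he : s(i, k) ∈ E) (hik : ¬ M.Adj i k) (hp : M.Adj k p)
    (huniq : ∀ k', s(i, k') ∈ E → ¬ M.Adj i k' → k' = k) :
    (x p - x k) / 2 - s ≤ x i ∧ x i ≤ max ε ((x p - x k) / 2) + s := by
  refine ⟨h.lower i hi k hk p he hik hp, ?_⟩
  rcases h.upper i hi with h1 | ⟨k', -, p', he', hik', hp', h1⟩
  · exact h1.trans (by gcongr; exact le_max_left _ _)
  · obtain rfl := huniq k' he' hik'
    obtain rfl := hF.isMatching.eq_of_adj_left hp hp'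
    exact h1.trans (by gcongr; exact le_max_right _ _)

theorem IsSpine.mem (h : IsSpine M E r L) (hF : IsFrame M C E) : ∀ j < 2 * L, r j ∈ C := by
  intro j hj
  rcases Nat.even_or_odd j with he | ho
  · have : j + 1 < 2 * L := by obtain ⟨a, rfl⟩ := he; omega
    exact hF.mem_of_edge _ _ (h.edge j this) ((h.alt j this).2 he)
  · obtain ⟨i, rfl⟩ := ho
    have h1 := (h.alt (2 * i) hj).2 (even_two_mul i)
    exact hF.closed _ _ h1 (hF.mem_of_edge _ _ (h.edge (2 * i) hj) h1)

theorem IsSpine.adj (h : IsSpine M E r L) {i : ℕ} (hi : i < L) :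
    M.Adj (r (2 * i)) (r (2 * i + 1)) := (h.alt (2 * i) (by omega)).2 (even_two_mul i)

/-- Put u i = (x (r (2 i)) - x (r (2 i + 1))) / 2. The only unmatched edge at the left node of pair
i + 1 comes from pair i, so it transmits u i, up to truncation at ε; symmetrically, the right node
of pair i receives -u (i + 1). Hence u i is nearly the mean of u (i - 1) and u (i + 1). -/
theorem IsSpine.left_bounds (h : IsSpine M E r L) (hF : IsFrame M C E)
    (hS : IsStatic M C E x ε s) {i : ℕ} (hi : i + 1 < L) :
    (x (r (2 * i)) - x (r (2 * i + 1))) / 2 - s ≤ x (r (2 * (i + 1))) ∧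
    x (r (2 * (i + 1))) ≤ max ε ((x (r (2 * i)) - x (r (2 * i + 1))) / 2) + s := by
  have hn := h.alt (2 * i + 1) (by omega)
  have hadj := h.adj hi
  rw [show 2 * (i + 1) = 2 * i + 1 + 1 by ring] at hadj ⊢
  have hn' : ¬ M.Adj (r (2 * i + 1 + 1)) (r (2 * i + 1)) := by
    rw [M.adj_comm, hn]; simp
  refine hS.bounds hF (h.mem hF _ (by omega)) (h.mem hF _ (by omega))
    (by rw [Sym2.eq_swap]; exact h.edge _ (by omega)) hn' (h.adj (by omega)).symm ?_
  intro k' hk' hk''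
  rcases h.nbr (2 * i + 1 + 1) (by omega) (by omega) k' hk' with h1 | h1
  · simpa using h1
  · exact absurd (h1 ▸ hadj) hk''

theorem IsSpine.right_bounds (h : IsSpine M E r L) (hF : IsFrame M C E)
    (hS : IsStatic M C E x ε s) {i : ℕ} (hi : i + 1 < L) :
    -((x (r (2 * (i + 1))) - x (r (2 * (i + 1) + 1))) / 2) - s ≤ x (r (2 * i + 1)) ∧
    x (r (2 * i + 1)) ≤
      max ε (-((x (r (2 * (i + 1))) - x (r (2 * (i + 1) + 1))) / 2)) + s := by
  have hn := h.alt (2 * i + 1) (by omega)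
  have hadj := h.adj hi
  have hadj' := h.adj (show i < L by omega)
  rw [show 2 * (i + 1) = 2 * i + 1 + 1 by ring] at hadj ⊢
  have hn' : ¬ M.Adj (r (2 * i + 1)) (r (2 * i + 1 + 1)) := by
    rw [hn]; simp
  rw [show ∀ a b : ℝ, -((a - b) / 2) = (b - a) / 2 by intros; ring]
  refine hS.bounds hF (h.mem hF _ (by omega)) (h.mem hF _ (by omega))
    (h.edge _ (by omega)) hn' hadj ?_
  intro k' hk' hk''
  rcases h.nbr (2 * i + 1) (by omega) (by omega) k' hk' with h1 | h1
  · exact absurd (h1 ▸ hadj'.symm) hk''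
  · exact h1

/-- Truncation at ε spoils harmonicity, but only upwards and to at most ε: it disappears under the
convex function max ε |·|, for which the averaging survives as an inequality. -/
theorem IsSpine.subharmonic_abs (h : IsSpine M E r L) (hF : IsFrame M C E)
    (hS : IsStatic M C E x ε s) (hs : 0 ≤ s) {a b : ℝ} (ha : max ε |x (r 0)| ≤ a)
    (hb : max ε |x (r (2 * (L - 1) + 1))| ≤ b) :
    Subharmonic (withEnds a (fun i => max ε |(x (r (2 * i)) - x (r (2 * i + 1))) / 2|) b L)
      L s := by
  refine withEnds_subharmonic h.pos (fun i => max ε |x (r (2 * i))|)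
    (fun i => max ε |x (r (2 * i + 1))|) ?_ ha hb hs ?_ ?_
  · intro i _
    apply max_le
    · linarith [le_max_left ε |x (r (2 * i))|, le_max_left ε |x (r (2 * i + 1))|]
    · rw [abs_div, abs_two]
      have := abs_sub (x (r (2 * i))) (x (r (2 * i + 1)))
      linarith [le_max_right ε |x (r (2 * i))|, le_max_right ε |x (r (2 * i + 1))|]
  · intro i hi
    obtain ⟨h1, h2⟩ := h.left_bounds hF hS hi
    set u := (x (r (2 * i)) - x (r (2 * i + 1))) / 2
    have e1 := le_max_left ε |u|
    have e2 := le_max_right ε |u|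
    have e3 := neg_abs_le u
    refine max_le (by linarith) (abs_le.2 ⟨by linarith, h2.trans ?_⟩)
    gcongr
    exact le_abs_self u
  · intro i hi
    obtain ⟨h1, h2⟩ := h.right_bounds hF hS hi
    set u := (x (r (2 * (i + 1))) - x (r (2 * (i + 1) + 1))) / 2
    have e1 := le_max_left ε |u|
    have e2 := le_max_right ε |u|
    have e3 := le_abs_self u
    refine max_le (by linarith) (abs_le.2 ⟨by linarith, h2.trans ?_⟩)
    gcongr
    exact neg_le_abs u

/-- The one-sided versions keep the sign of u. They are needed on odd cycles, whose two ends feed in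
opposite signs. -/
theorem IsSpine.subharmonic_pos (h : IsSpine M E r L) (hF : IsFrame M C E)
    (hS : IsStatic M C E x ε s) (hs : 0 ≤ s) {a b : ℝ} (ha : max ε (x (r 0)) ≤ a)
    (hb : max ε (-x (r (2 * (L - 1) + 1))) ≤ b) :
    Subharmonic (withEnds a (fun i => max ε ((x (r (2 * i)) - x (r (2 * i + 1))) / 2)) b L)
      L s := by
  refine withEnds_subharmonic h.pos (fun i => max ε (x (r (2 * i))))
    (fun i => max ε (-x (r (2 * i + 1)))) ?_ ha hb hs ?_ ?_
  · intro i _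
    apply max_le
    · linarith [le_max_left ε (x (r (2 * i))), le_max_left ε (-x (r (2 * i + 1)))]
    · linarith [le_max_right ε (x (r (2 * i))), le_max_right ε (-x (r (2 * i + 1)))]
  · intro i hi
    obtain ⟨h1, h2⟩ := h.left_bounds hF hS hi
    exact max_le (by linarith [le_max_left ε ((x (r (2 * i)) - x (r (2 * i + 1))) / 2)]) h2
  · intro i hi
    obtain ⟨h1, h2⟩ := h.right_bounds hF hS hi
    set u := (x (r (2 * (i + 1))) - x (r (2 * (i + 1) + 1))) / 2
    exact max_le (by linarith [le_max_left ε u]) (by linarith [le_max_right ε u])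

theorem IsSpine.subharmonic_neg (h : IsSpine M E r L) (hF : IsFrame M C E)
    (hS : IsStatic M C E x ε s) (hs : 0 ≤ s) {a b : ℝ} (ha : max ε (-x (r 0)) ≤ a)
    (hb : max ε (x (r (2 * (L - 1) + 1))) ≤ b) :
    Subharmonic (withEnds a (fun i => max ε (-((x (r (2 * i)) - x (r (2 * i + 1))) / 2))) b L)
      L s := by
  refine withEnds_subharmonic h.pos (fun i => max ε (-x (r (2 * i))))
    (fun i => max ε (x (r (2 * i + 1)))) ?_ ha hb hs ?_ ?_
  · intro i _
    apply max_le
    · linarith [le_max_left ε (-x (r (2 * i))), le_max_left ε (x (r (2 * i + 1)))]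
    · linarith [le_max_right ε (-x (r (2 * i))), le_max_right ε (x (r (2 * i + 1)))]
  · intro i hi
    obtain ⟨h1, h2⟩ := h.left_bounds hF hS hi
    set u := (x (r (2 * i)) - x (r (2 * i + 1))) / 2
    exact max_le (by linarith [le_max_left ε (-u)]) (by linarith [le_max_right ε (-u)])
  · intro i hi
    obtain ⟨h1, h2⟩ := h.right_bounds hF hS hi
    set u := (x (r (2 * (i + 1))) - x (r (2 * (i + 1) + 1))) / 2
    exact max_le (by linarith [le_max_left ε (-u)]) h2

theorem IsSpine.abs_le_of_pairs (h : IsSpine M E r L) (hF : IsFrame M C E)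
    (hS : IsStatic M C E x ε s) {c : ℝ} (hε : ε ≤ c)
    (h0 : |x (r 0)| ≤ c + s) (h1 : |x (r (2 * (L - 1) + 1))| ≤ c + s)
    (hu : ∀ i < L, |(x (r (2 * i)) - x (r (2 * i + 1))) / 2| ≤ c) :
    ∀ j < 2 * L, |x (r j)| ≤ c + s := by
  intro j hj
  obtain ⟨i, rfl | rfl⟩ := Nat.even_or_odd' j
  · rcases i with _ | i
    · exact h0
    · obtain ⟨e1, e2⟩ := h.left_bounds hF hS (i := i) (by omega)
      have := abs_le.1 (hu i (by omega))
      exact abs_le.2 ⟨by linarith, e2.trans (by gcongr; exact max_le hε this.2)⟩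
  · rcases (show i + 1 ≤ L by omega).eq_or_lt with hi | hi
    · rw [show i = L - 1 by omega]; exact h1
    · obtain ⟨e1, e2⟩ := h.right_bounds hF hS hi
      have := abs_le.1 (hu (i + 1) (by omega))
      exact abs_le.2 ⟨by linarith, e2.trans (by gcongr; exact max_le hε (by linarith))⟩

theorem IsSpine.bound (h : IsSpine M E r L) (hF : IsFrame M C E)
    (hS : IsStatic M C E x ε s) (hs : 0 ≤ s) (hn : 1 ≤ n) (hL : (L : ℝ) ≤ n)
    (h0 : EndDamped x ε s n (r 0) (r 1))
    (h1 : EndDamped x ε s n (r (2 * (L - 1) + 1)) (r (2 * (L - 1)))) :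
    ∀ j < 2 * L, |x (r j)| ≤ ε + 10 * n ^ 2 * s := by
  have hLpos := h.pos
  have hnn : s ≤ n ^ 2 * s := le_mul_of_one_le_left hs (by nlinarith)
  have hsub := h.subharmonic_abs hF hS hs le_rfl le_rfl
  set u : ℕ → ℝ := fun i => max ε |(x (r (2 * i)) - x (r (2 * i + 1))) / 2| with hu
  have hg := hsub.bound hs hn h.pos hL (ε := ε) ?_ ?_ ?_
  · have hall : ∀ i < L, u i ≤ ε + 9 * n ^ 2 * s := by
      intro i hi
      have := hg (i + 1) (by omega)
      simpa only [withEnds, if_pos hi] using this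
    have g0 := hg 0 (by omega)
    have g1 := hg (L + 1) le_rfl
    simp only [withEnds, lt_irrefl, if_false] at g0 g1
    have := h.abs_le_of_pairs hF hS (c := ε + 9 * n ^ 2 * s) (by nlinarith)
      ((le_max_right _ _).trans (g0.trans (by linarith)))
      ((le_max_right _ _).trans (g1.trans (by linarith)))
      (fun i hi => (le_max_right _ _).trans (hall i hi))
    intro j hj
    exact (this j hj).trans (by linarith)
  · intro i hi
    rcases i with _ | i
    · exact le_max_left _ _
    · simp only [withEnds]
      split_ifs
      · exact le_max_left _ _
      · exact le_max_left _ _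
  · unfold EndDamped at h0
    simpa only [withEnds, if_pos hLpos, hu, mul_zero, zero_add] using h0
  · obtain ⟨l, rfl⟩ : ∃ l, L = l + 1 := ⟨L - 1, by omega⟩
    simp only [withEnds, lt_irrefl, if_false, Nat.lt_succ_self, if_true, hu]
    rw [EndDamped, ← abs_neg ((x _ - x _) / 2), ← neg_div, neg_sub] at h1
    simpa using h1

/-- No structure edge inside `C` feeds such an end, so |x e| ≤ ε + s: the end absorbs. -/
theorem endDamped_of_killed (hS : IsStatic M C E x ε s) (hs : 0 ≤ s) (hn : 1 ≤ n)
    {e : V} (e' : V) (he : e ∈ C) (hk : ∀ k ∈ C, s(e, k) ∈ E → M.Adj e k) :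
    EndDamped x ε s n e e' := by
  have h1 : x e ≤ ε + s := by
    rcases hS.upper e he with h1 | ⟨k, hkC, p, hE, hM, -⟩
    · exact h1
    · exact absurd (hk k hkC hE) hM
  have h2 := hS.bottom e he hk
  have h3 : max ε |x e| ≤ ε + s := max_le (by linarith) (abs_le.2 ⟨by linarith, h1⟩)
  have h4 : 1 / n ≤ 1 := (div_le_one (by linarith)).2 hn
  have h5 : 0 ≤ (1 - 1 / n) * (max ε |(x e - x e') / 2| - ε) :=
    mul_nonneg (by linarith) (by linarith [le_max_left ε |(x e - x e') / 2|])
  have : s ≤ 2 * n * s := le_mul_of_one_le_left hs (by linarith)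
  unfold EndDamped
  linarith

/-- Since y and -y have opposite signs, at most one of X and Y exceeds ε + s. The chord gives it a
weight of at most m / (m + 1), hence at most 1 - 1/n. -/
theorem chord_bound {m : ℕ} {X Y Z y : ℝ} (hm : 0 < m) (hmn : (m : ℝ) + 1 ≤ n) (hε : 0 ≤ ε)
    (hs : 0 ≤ s) (hZ : ((m : ℝ) + 1) * Z ≤ m * X + Y + s * (m * (m + 1)))
    (hX : X ≤ max ε y + s) (hY : Y ≤ max ε (-y) + s) :
    Z ≤ ε + (1 - 1 / n) * (max ε |y| - ε) + n * s := by
  have hm1 : (1 : ℝ) ≤ m := by exact_mod_cast hm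
  set q := max ε |y| - ε with hq
  have hq0 : 0 ≤ q := by linarith [le_max_left ε |y|]
  have hXY : (m : ℝ) * X + Y ≤ (m + 1) * (ε + s) + m * q := by
    rcases le_total 0 y with h | h
    · have e1 : max ε y = ε + q := by rw [hq, abs_of_nonneg h]; ring
      have e2 : max ε (-y) = ε := max_eq_left (by linarith)
      rw [e1] at hX
      rw [e2] at hY
      nlinarith
    · have e1 : max ε y = ε := max_eq_left (by linarith)
      have e2 : max ε (-y) = ε + q := by rw [hq, abs_of_nonpos h]; ring
      rw [e1] at hX
      rw [e2] at hY
      nlinarith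
  have h1 : 1 / n ≤ 1 / ((m : ℝ) + 1) := one_div_le_one_div_of_le (by linarith) hmn
  have h2 : Z ≤ ε + (1 - 1 / ((m : ℝ) + 1)) * q + (m + 1) * s := by
    have e : (1 - 1 / ((m : ℝ) + 1)) * (m + 1) = m := by field_simp; ring
    have : ((m : ℝ) + 1) * Z ≤ (m + 1) * (ε + (1 - 1 / ((m : ℝ) + 1)) * q + (m + 1) * s) := by
      calc ((m : ℝ) + 1) * Z ≤ (m + 1) * (ε + s) + m * q + s * (m * (m + 1)) := by linarith
        _ = (m + 1) * (ε + s) + ((1 - 1 / ((m : ℝ) + 1)) * (m + 1)) * q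
            + s * (m * (m + 1)) := by rw [e]
        _ = _ := by ring
    exact le_of_mul_le_mul_left this (by linarith)
  refine h2.trans ?_
  have h3 := mul_le_mul_of_nonneg_right h1 hq0
  have h4 := mul_le_mul_of_nonneg_right hmn hs
  linarith

/-- An odd cycle attached to the end `e` of a spine. -/
structure IsEndCycle (M : G.Subgraph) (E : Set (Sym2 V)) (c : ℕ → V) (b : ℕ) (e e' : V) :
    Prop where
  odd : IsOddCycle M c b
  base : c 0 = e
  partner : M.Adj e e'
  edge : ∀ j < b, s(c j, c (j + 1)) ∈ E
  nbr : ∀ j, 0 < j → j < b → ∀ k, s(c j, k) ∈ E → k = c (j - 1) ∨ k = c (j + 1)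
  base_nbr : ∀ k, s(e, k) ∈ E → ¬ M.Adj e k → k = c 1 ∨ k = c (b - 1)

/-- Without its base, the odd cycle is a spine: both edges at the base are unmatched. -/
theorem IsEndCycle.isSpine {c : ℕ → V} {b : ℕ} {e e' : V} (h : IsEndCycle M E c b e e') :
    IsSpine M E (fun i => c (i + 1)) ((b - 1) / 2) := by
  obtain ⟨hb, hodd, -, -, halt⟩ := h.odd
  obtain ⟨m, hm⟩ := hodd
  constructor
  · omega
  · intro j hj
    exact h.edge (j + 1) (by omega)
  · intro j hj
    rw [halt (j + 1) (by omega), Nat.odd_add_one, Nat.not_odd_iff_even]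
  · intro j hj hj' k hk
    have := h.nbr (j + 1) (by omega) (by omega) k hk
    rwa [show j - 1 + 1 = j + 1 - 1 by omega]

theorem IsEndCycle.mem {c : ℕ → V} {b : ℕ} {e e' : V} (h : IsEndCycle M E c b e e')
    (hF : IsFrame M C E) (j : ℕ) (h0 : 0 < j) (hj : j < b) : c j ∈ C := by
  obtain ⟨hb, ⟨m, hm⟩, -⟩ := h.odd
  have := h.isSpine.mem hF (j - 1) (by omega)
  rwa [show j - 1 + 1 = j by omega] at this

theorem IsEndCycle.entry_bounds {c : ℕ → V} {b : ℕ} {e e' : V} (h : IsEndCycle M E c b e e')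
    (hF : IsFrame M C E) (hS : IsStatic M C E x ε s) (he : e ∈ C) :
    ((x e' - x e) / 2 - s ≤ x (c 1) ∧ x (c 1) ≤ max ε ((x e' - x e) / 2) + s) ∧
    ((x e' - x e) / 2 - s ≤ x (c (b - 1)) ∧
      x (c (b - 1)) ≤ max ε ((x e' - x e) / 2) + s) := by
  obtain ⟨hb, hodd, hcb, -, halt⟩ := h.odd
  have hbase := h.base
  obtain ⟨m, hm⟩ := hodd
  constructor
  · have hn : ¬ M.Adj (c 1) e := by
      rw [M.adj_comm, ← hbase, halt 0 (by omega)]; decide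
    refine hS.bounds hF (h.mem hF _ (by omega) (by omega)) he ?_ hn h.partner ?_
    · rw [Sym2.eq_swap, ← hbase]; exact h.edge 0 (by omega)
    · intro k hk hk'
      rcases h.nbr 1 (by omega) (by omega) k hk with h1 | h1
      · rw [h1, ← hbase]
      · exact absurd (h1 ▸ (halt 1 (by omega)).2 (by decide)) hk'
  · have h2 := h.edge (b - 1) (by omega)
    have h3 := halt (b - 1) (by omega)
    have h4 := halt (b - 2) (by omega)
    rw [show b - 1 + 1 = b by omega, hcb, hbase] at h2 h3
    rw [show b - 2 + 1 = b - 1 by omega] at h4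
    refine hS.bounds hF (h.mem hF _ (by omega) (by omega)) he h2 ?_ h.partner ?_
    · rw [h3, Nat.not_odd_iff_even]; exact ⟨m, by omega⟩
    · intro k hk hk'
      rcases h.nbr (b - 1) (by omega) (by omega) k hk with h1 | h1
      · rw [show b - 1 - 1 = b - 2 by omega] at h1
        exact absurd (h1 ▸ (h4.2 ⟨m - 1, by omega⟩).symm) hk'
      · rw [h1, show b - 1 + 1 = b by omega, hcb, hbase]

/-- The base sends the same value y = (x e' - x e) / 2 into both ends of the cycle's spine. Oriented
along the spine these inputs are y and -y, so they compete, and by the chord bounds what comes back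
to the base is smaller than |y| by a factor 1 - 1/n beyond ε. -/
theorem IsEndCycle.endDamped {c : ℕ → V} {b : ℕ} {e e' : V} (h : IsEndCycle M E c b e e')
    (hF : IsFrame M C E) (hS : IsStatic M C E x ε s) (hs : 0 ≤ s) (hε : 0 ≤ ε) (hn : (b : ℝ) ≤ n)
    (he : e ∈ C) : EndDamped x ε s n e e' := by
  have hsp := h.isSpine
  obtain ⟨⟨l1, u1⟩, ⟨l2, u2⟩⟩ := h.entry_bounds hF hS he
  have hmem := h.mem hF
  have hbnbr := h.base_nbr
  have hbase := h.base
  have hedge := h.edge 0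
  obtain ⟨hb, hodd, hcb, -, halt⟩ := h.odd
  obtain ⟨m, rfl⟩ := hodd
  have hm : 0 < m := by omega
  rw [show (2 * m + 1 - 1) / 2 = m by omega] at hsp
  rw [show 2 * m + 1 - 1 = 2 * m by omega] at l2 u2 hbnbr
  have hidx : 2 * (m - 1) + 1 + 1 = 2 * m := by omega
  have hmn : (m : ℝ) + 1 ≤ n := by
    have : (m : ℝ) + 1 ≤ ((2 * m + 1 : ℕ) : ℝ) := by exact_mod_cast (by omega)
    linarith
  set y := (x e' - x e) / 2 with hy
  have hεy := le_max_left ε y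
  have hεy' := le_max_left ε (-y)
  have hyy' := le_max_right ε (-y)
  have hyy := le_max_right ε y
  have subp := hsp.subharmonic_pos hF hS hs (a := max ε y + s) (b := max ε (-y) + s)
    (max_le (by linarith) u1) (by
      simp only [hidx]; exact max_le (by linarith) (by linarith))
  have subn := hsp.subharmonic_neg hF hS hs (a := max ε (-y) + s) (b := max ε y + s)
    (max_le (by linarith) (by simp only [zero_add]; linarith)) (by
      simp only [hidx]; exact max_le (by linarith) u2)
  have p1 := subp.first
  have p2 := subp.last
  have n1 := subn.first
  obtain ⟨l, rfl⟩ : ∃ l, m = l + 1 := ⟨m - 1, by omega⟩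
  simp only [withEnds, lt_irrefl, if_false, Nat.lt_succ_self, if_true, hm] at p1 p2 n1
  set β := ε + (1 - 1 / n) * (max ε |y| - ε) + n * s with hβ
  have b1 := (le_max_right _ _).trans (chord_bound hm hmn hε hs p1 le_rfl le_rfl)
  have b2 := (le_max_right _ _).trans
    (chord_bound (y := -y) hm hmn hε hs p2 le_rfl (by rw [neg_neg]))
  have b3 := (le_max_right _ _).trans
    (chord_bound (y := -y) hm hmn hε hs n1 le_rfl (by rw [neg_neg]))
  rw [abs_neg] at b2 b3
  rw [← hβ] at b1 b2 b3
  simp only [mul_zero, zero_add, Nat.reduceAdd] at b1 b3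
  have hn1 : 1 ≤ n := by
    have : (0 : ℝ) ≤ ((l + 1 : ℕ) : ℝ) := Nat.cast_nonneg _
    linarith
  have hεβ : ε ≤ β := by
    have h4 : 1 / n ≤ 1 := (div_le_one (by linarith)).2 hn1
    have h5 : 0 ≤ (1 - 1 / n) * (max ε |y| - ε) :=
      mul_nonneg (by linarith) (by linarith [le_max_left ε |y|])
    have : 0 ≤ n * s := mul_nonneg (by linarith) hs
    linarith
  have adj12 : M.Adj (c 1) (c 2) := (halt 1 (by omega)).2 (by decide)
  have nadj : ¬ M.Adj e (c 1) := by
    rw [← hbase, halt 0 (by omega)]; decide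
  -- The value at the base is the larger of those returned by the two cycle edges: both are bounded
  -- above (`b2`, `b3`), and one lower bound (`b1`) suffices.
  have hlow := hS.lower e he (c 1) (hmem 1 (by omega) (by omega)) (c 2)
    (by rw [← hbase]; exact hedge (by omega)) nadj adj12
  have hup : x e ≤ β + s := by
    rcases hS.upper e he with h1 | ⟨k, -, p, hE, hM, hp, h1⟩
    · linarith
    · rcases hbnbr k hE hM with rfl | rfl
      · obtain rfl := hF.isMatching.eq_of_adj_left hp adj12
        linarith
      · have adj' := (halt (2 * l + 1) (by omega)).2 ⟨l, rfl⟩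
        rw [show 2 * l + 1 + 1 = 2 * (l + 1) by ring] at adj'
        obtain rfl := hF.isMatching.eq_of_adj_left hp adj'.symm
        rw [show 2 * l + 1 + 1 = 2 * (l + 1) by ring] at b2
        linarith
  have hyabs : |(x e - x e') / 2| = |y| := by
    rw [hy, ← abs_neg, ← neg_div, neg_sub]
  unfold EndDamped
  rw [hyabs]
  have hsn : s ≤ n * s := le_mul_of_one_le_left hs hn1
  have : max ε |x e| ≤ β + s := max_le (by linarith) (abs_le.2 ⟨by linarith, hup⟩)
  linarith

theorem IsEndCycle.bound {c : ℕ → V} {b : ℕ} {e e' : V} (h : IsEndCycle M E c b e e')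
    (hF : IsFrame M C E) (hS : IsStatic M C E x ε s) (hs : 0 ≤ s) (hn : (b : ℝ) ≤ n)
    (he : e ∈ C) {a : ℝ} (hεa : ε ≤ a) (ha : |x e| ≤ a) (ha' : |x e'| ≤ a) :
    ∀ j, 0 < j → j < b → |x (c j)| ≤ a + 3 * n ^ 2 * s := by
  have hsp := h.isSpine
  obtain ⟨⟨l1, u1⟩, ⟨l2, u2⟩⟩ := h.entry_bounds hF hS he
  obtain ⟨hb, hodd, hcb, -, halt⟩ := h.odd
  obtain ⟨m, rfl⟩ := hodd
  rw [show (2 * m + 1 - 1) / 2 = m by omega] at hsp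
  rw [show 2 * m + 1 - 1 = 2 * m by omega] at l2 u2
  have hidx : 2 * (m - 1) + 1 + 1 = 2 * m := by omega
  rw [abs_le] at ha ha'
  have hya : max ε ((x e' - x e) / 2) ≤ a := max_le hεa (by linarith)
  have c1 : |x (c 1)| ≤ a + s := abs_le.2 ⟨by linarith, by linarith⟩
  have c2 : |x (c (2 * m))| ≤ a + s := abs_le.2 ⟨by linarith, by linarith⟩
  have sub := hsp.subharmonic_abs hF hS hs (a := a + s) (b := a + s)
    (max_le (by linarith) c1) (by simp only [hidx]; exact max_le (by linarith) c2)
  have hall := sub.le_of_ends (c := a + s) le_rfl (by simp [withEnds]) hs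
  have hmm : s * (m : ℝ) ^ 2 ≤ n ^ 2 * s := by
    have : (m : ℝ) ≤ n := by
      have : (m : ℝ) ≤ ((2 * m + 1 : ℕ) : ℝ) := by exact_mod_cast (by omega)
      linarith
    rw [mul_comm]
    gcongr
  have hn1 : (1 : ℝ) ≤ n := by
    have : (1 : ℝ) ≤ ((2 * m + 1 : ℕ) : ℝ) := by exact_mod_cast (by omega)
    linarith
  have hsn : s ≤ n ^ 2 * s := le_mul_of_one_le_left hs (by nlinarith)
  have hp : 0 ≤ s * (m : ℝ) ^ 2 := by positivity
  have := hsp.abs_le_of_pairs hF hS (c := a + s + s * m ^ 2) (by linarith)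
    (c1.trans (by linarith)) (by simp only [hidx]; exact c2.trans (by linarith)) ?_
  · intro j h0 hj
    have h1 := this (j - 1) (by omega)
    simp only [show j - 1 + 1 = j by omega] at h1
    linarith
  · intro i hi
    have := hall (i + 1) (by omega)
    simp only [withEnds, if_pos hi] at this
    exact (le_max_right _ _).trans this

end Static

/-! ### The path, blossom and bicycle topologies -/

section Structures

variable {V : Type u} {G : SimpleGraph V} {M : G.Subgraph} {C : Set V} {E : Set (Sym2 V)}
  {x : V → ℝ} {ε s n : ℝ}

theorem mem_seqEdges {p : ℕ → V} {ℓ : ℕ} {v k : V} (h : s(v, k) ∈ seqEdges p ℓ) :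
    ∃ j < ℓ, (v = p j ∧ k = p (j + 1)) ∨ (v = p (j + 1) ∧ k = p j) := by
  obtain ⟨j, hj, h⟩ := h
  exact ⟨j, hj, Sym2.eq_iff.1 h⟩

theorem not_mem_seqEdges {p : ℕ → V} {ℓ : ℕ} {v : V} (h : ∀ i ≤ ℓ, v ≠ p i) (k : V) :
    s(v, k) ∉ seqEdges p ℓ := by
  intro hk
  obtain ⟨j, hj, ⟨h1, -⟩ | ⟨h1, -⟩⟩ := mem_seqEdges hk
  · exact h j hj.le h1
  · exact h (j + 1) hj h1

theorem seqEdges_nbr {p : ℕ → V} {ℓ j : ℕ} (hinj : ∀ i ≤ ℓ, p j = p i → j = i) {k : V}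
    (h : s(p j, k) ∈ seqEdges p ℓ) :
    (0 < j ∧ k = p (j - 1)) ∨ (j < ℓ ∧ k = p (j + 1)) := by
  obtain ⟨i, hi, ⟨h1, h2⟩ | ⟨h1, h2⟩⟩ := mem_seqEdges h
  · obtain rfl := hinj i hi.le h1
    exact Or.inr ⟨hi, h2⟩
  · obtain rfl := hinj (i + 1) hi h1
    exact Or.inl ⟨by omega, by simpa using h2⟩

theorem IsOddCycle.ne_of_lt {c : ℕ → V} {b : ℕ} (h : IsOddCycle M c b) {v : V}
    (hv : ∀ j < b, v ≠ c j) : ∀ j ≤ b, v ≠ c j := by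
  obtain ⟨hb, -, hcb, -⟩ := h
  intro j hj
  rcases hj.eq_or_lt with rfl | hj
  · rw [hcb]; exact hv 0 (by omega)
  · exact hv j hj

theorem IsOddCycle.nbr {c : ℕ → V} {b : ℕ} (h : IsOddCycle M c b) {j : ℕ} (h0 : 0 < j)
    (hj : j < b) {k : V} (hk : s(c j, k) ∈ seqEdges c b) : k = c (j - 1) ∨ k = c (j + 1) := by
  obtain ⟨hb, -, hcb, hinj, -⟩ := h
  have : ∀ i ≤ b, c j = c i → j = i := by
    intro i hi he
    rcases hi.eq_or_lt with rfl | hi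
    · rw [hcb] at he
      exact absurd (hinj (Set.mem_Iio.2 hj) (Set.mem_Iio.2 (by omega)) he) (by omega)
    · exact hinj (Set.mem_Iio.2 hj) (Set.mem_Iio.2 hi) he
  rcases seqEdges_nbr this hk with h1 | h1
  · exact Or.inl h1.2
  · exact Or.inr h1.2

theorem IsOddCycle.base_nbr {c : ℕ → V} {b : ℕ} (h : IsOddCycle M c b) {k : V}
    (hk : s(c 0, k) ∈ seqEdges c b) : k = c 1 ∨ k = c (b - 1) := by
  obtain ⟨hb, -, hcb, hinj, -⟩ := h
  have h0 : ∀ i < b, c 0 = c i → 0 = i := fun i hi he =>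
    hinj (Set.mem_Iio.2 (by omega)) (Set.mem_Iio.2 hi) he
  obtain ⟨i, hi, ⟨h1, h2⟩ | ⟨h1, h2⟩⟩ := mem_seqEdges hk
  · obtain rfl := h0 i hi h1
    exact Or.inl h2
  · rcases (show i + 1 ≤ b from hi).eq_or_lt with h3 | h3
    · right; rw [h2, ← h3]; simp
    · exact absurd (h0 (i + 1) h3 h1) (by omega)

/-- A sequence of edges of `E` that alternates, whose matching edges are at the indices of the
parity of `o`, and whose inner nodes have no further neighbours in `E`. -/
structure IsAltSeq (M : G.Subgraph) (E : Set (Sym2 V)) (p : ℕ → V) (ℓ o : ℕ) : Prop where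
  le_one : o ≤ 1
  lt : o < ℓ
  edge : ∀ j < ℓ, s(p j, p (j + 1)) ∈ E
  alt : ∀ j < ℓ, (M.Adj (p j) (p (j + 1)) ↔ Even (j + o))
  nbr : ∀ j, 0 < j → j < ℓ → ∀ k, s(p j, k) ∈ E → k = p (j - 1) ∨ k = p (j + 1)

variable {p : ℕ → V} {ℓ o : ℕ}

/-- Skipping o edges makes the spine start with a matching edge, and the rounding drops a last edge
that is unmatched; (ℓ - o + 1) / 2 counts the matching edges. -/
theorem IsAltSeq.isSpine (h : IsAltSeq M E p ℓ o) :
    IsSpine M E (fun j => p (j + o)) ((ℓ - o + 1) / 2) := by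
  have h1 := h.le_one
  have h2 := h.lt
  constructor
  · omega
  · intro j hj
    simp only [show j + 1 + o = j + o + 1 by omega]
    exact h.edge _ (by omega)
  · intro j hj
    simp only [show j + 1 + o = j + o + 1 by omega]
    rw [h.alt _ (by omega), add_assoc, Nat.even_add]
    simp
  · intro j h0 hj k hk
    have := h.nbr (j + o) (by omega) (by omega) k hk
    simpa only [show j + o - 1 = j - 1 + o by omega, show j + o + 1 = j + 1 + o by omega] using this

theorem IsAltSeq.index (h : IsAltSeq M E p ℓ o) {j : ℕ} (hj : j < ℓ) (he : Even (j + o)) :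
    o ≤ j ∧ j + 1 - o < 2 * ((ℓ - o + 1) / 2) := by
  have h1 := h.le_one
  have h2 := h.lt
  obtain ⟨a, ha⟩ := he
  omega

theorem adj_of_leaf {v v' : V} (ha : M.Adj v v') (hv : ∀ k, s(v, k) ∈ E → k = v') :
    ∀ k ∈ C, s(v, k) ∈ E → M.Adj v k := by
  intro k _ hk
  rwa [hv k hk]

/-- The other end t of the unmatched edge lies outside `C`: otherwise its matching edge would be in
`E`, hence would be the edge to v. -/
theorem adj_of_anchored (hF : IsFrame M C E) {v m t : V} (hm : M.Adj v m)
    (hv : ∀ k, s(v, k) ∈ E → k = m ∨ k = t) (htv : ¬ M.Adj v t)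
    (ht : t ∈ C → ∀ k, s(t, k) ∈ E → k = v) : ∀ k ∈ C, s(v, k) ∈ E → M.Adj v k := by
  intro k hkC hk
  rcases hv k hk with rfl | rfl
  · exact hm
  · obtain ⟨q, hq⟩ := hF.exists_partner _ hkC
    obtain rfl := ht hkC q (hF.edge_mem _ _ hq hkC)
    exact hq.symm

/-- If the last edge is matched, the spine ends at p ℓ, a leaf. Otherwise it ends at p (ℓ - 1), and
p ℓ is an anchor. -/
theorem IsAltSeq.right_end (h : IsAltSeq M E p ℓ o) (hF : IsFrame M C E)
    (hend : p ℓ ∈ C → ∀ k, s(p ℓ, k) ∈ E → k = p (ℓ - 1)) :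
    ∀ k ∈ C, s(p (2 * ((ℓ - o + 1) / 2 - 1) + 1 + o), k) ∈ E →
      M.Adj (p (2 * ((ℓ - o + 1) / 2 - 1) + 1 + o)) k := by
  have h1 := h.le_one
  have h2 := h.lt
  have halt := h.alt (ℓ - 1) (by omega)
  rw [show ℓ - 1 + 1 = ℓ by omega] at halt
  by_cases hpar : Even (ℓ - 1 + o)
  · have hadj := halt.2 hpar
    have : 2 * ((ℓ - o + 1) / 2 - 1) + 1 + o = ℓ := by obtain ⟨a, ha⟩ := hpar; omega
    rw [this]
    have hE := h.edge (ℓ - 1) (by omega)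
    rw [show ℓ - 1 + 1 = ℓ by omega] at hE
    have hC : p ℓ ∈ C := hF.closed _ _ hadj (hF.mem_of_edge _ _ hE hadj)
    exact adj_of_leaf hadj.symm (hend hC)
  · have hnadj := fun hh => hpar (halt.1 hh)
    rw [Nat.not_even_iff_odd] at hpar
    have : 2 * ((ℓ - o + 1) / 2 - 1) + 1 + o = ℓ - 1 := by obtain ⟨a, ha⟩ := hpar; omega
    rw [this]
    have hℓ : 2 ≤ ℓ := by obtain ⟨a, ha⟩ := hpar; omega
    have halt2 := h.alt (ℓ - 2) (by omega)
    rw [show ℓ - 2 + 1 = ℓ - 1 by omega] at halt2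
    have hadj := halt2.2 (by obtain ⟨a, ha⟩ := hpar; exact ⟨a, by omega⟩)
    refine adj_of_anchored hF hadj.symm ?_ hnadj hend
    intro k hk
    have := h.nbr (ℓ - 1) (by omega) (by omega) k hk
    rwa [show ℓ - 1 - 1 = ℓ - 2 by omega, show ℓ - 1 + 1 = ℓ by omega] at this

theorem IsAltSeq.left_end (h : IsAltSeq M E p ℓ o) (hF : IsFrame M C E)
    (hend : p 0 ∈ C → ∀ k, s(p 0, k) ∈ E → k = p 1) :
    ∀ k ∈ C, s(p o, k) ∈ E → M.Adj (p o) k := by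
  have h1 := h.le_one
  have h2 := h.lt
  have halt := h.alt 0 (by omega)
  obtain rfl | rfl : o = 0 ∨ o = 1 := by omega
  · have hadj := halt.2 (by simp)
    exact adj_of_leaf hadj (hend (hF.mem_of_edge _ _ (h.edge 0 (by omega)) hadj))
  · have hnadj : ¬ M.Adj (p 1) (p 0) := by
      rw [M.adj_comm, halt]; decide
    have hadj := (h.alt 1 (by omega)).2 (by decide)
    refine adj_of_anchored hF hadj ?_ hnadj hend
    intro k hk
    exact (h.nbr 1 (by omega) (by omega) k hk).symm

theorem le_card_of_injective_below [Fintype V] {m : ℕ} {f : ℕ → V}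
    (hf : ∀ i < m, ∀ j < m, f i = f j → i = j) : m ≤ Fintype.card V := by
  classical
  have h : Set.InjOn f (Finset.range m) := by
    intro i hi j hj hij
    exact hf i (by simpa using hi) j (by simpa using hj) hij
  have := Finset.card_le_univ ((Finset.range m).image f)
  rwa [Finset.card_image_of_injOn h, Finset.card_range] at this

theorem IsAlternatingPath.bound [Fintype V] (hF : IsFrame M C E) (hS : IsStatic M C E x ε s)
    (hs : 0 ≤ s) (hne : C.Nonempty) (hT : IsAlternatingPath M C E) :
    ∀ i ∈ C, |x i| ≤ ε + 10 * (Fintype.card V : ℝ) ^ 2 * s := by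
  obtain ⟨ℓ, p, hℓ, hinj, halt, rfl⟩ := hT
  obtain ⟨o, ho1, ho⟩ : ∃ o ≤ 1, (M.Adj (p 0) (p 1) ↔ Even o) := by
    by_cases h : M.Adj (p 0) (p 1)
    · exact ⟨0, by omega, by simpa using h⟩
    · exact ⟨1, le_rfl, by simpa using h⟩
  have halt' : ∀ j < ℓ, (M.Adj (p j) (p (j + 1)) ↔ Even (j + o)) := by
    intro j
    induction j with
    | zero => intro _; simpa using ho
    | succ j ih =>
      intro hj
      have h1 := ih (by omega)
      have h2 := halt j hj
      rw [show j + 1 + o = j + o + 1 by omega, Nat.even_add_one]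
      tauto
  have hmatched : ∀ i ∈ C, ∃ j < ℓ, Even (j + o) ∧ (i = p j ∨ i = p (j + 1)) := by
    intro i hi
    obtain ⟨q, hq⟩ := hF.exists_partner i hi
    obtain ⟨j, hj, ⟨rfl, rfl⟩ | ⟨rfl, rfl⟩⟩ := mem_seqEdges (hF.edge_mem i q hq hi)
    · exact ⟨j, hj, (halt' j hj).1 hq, Or.inl rfl⟩
    · exact ⟨j, hj, (halt' j hj).1 hq.symm, Or.inr rfl⟩
  -- The ends may coincide only outside `C`, so nodes of `C`, and thus the whole spine, are visited
  -- once.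
  have hinjC : ∀ j, j ≤ ℓ → p j ∈ C → ∀ i ≤ ℓ, p j = p i → j = i := by
    intro j hj hC i hi he
    rcases lt_trichotomy j i with h | h | h
    · obtain ⟨rfl, -, h0⟩ := hinj j i h hi he
      exact absurd hC h0
    · exact h
    · obtain ⟨rfl, -, h0⟩ := hinj i j h hj he.symm
      exact absurd (he ▸ hC) h0
  have hseq : IsAltSeq M (seqEdges p ℓ) p ℓ o := by
    refine ⟨ho1, ?_, fun j hj => ⟨j, hj, rfl⟩, halt', ?_⟩
    · obtain ⟨i, hi⟩ := hne
      obtain ⟨j, hj, ⟨a, ha⟩, -⟩ := hmatched i hi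
      omega
    · intro j h0 hj k hk
      have : ∀ i ≤ ℓ, p j = p i → j = i := by
        intro i hi he
        rcases lt_trichotomy j i with h | h | h
        · have := (hinj j i h hi he).1; omega
        · exact h
        · have := (hinj i j h hj.le he.symm).2.1; omega
      rcases seqEdges_nbr this hk with h | h
      · exact Or.inl h.2
      · exact Or.inr h.2
  have hsp := hseq.isSpine
  have hmem := hsp.mem hF
  have hlt := hseq.lt
  have hcard : 2 * ((ℓ - o + 1) / 2) ≤ Fintype.card V := by
    refine le_card_of_injective_below (f := fun j => p (j + o)) ?_
    intro i hi j hj he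
    have := hinjC (i + o) (by omega) (hmem i hi) (j + o) (by omega) he
    omega
  have hcard' : (((ℓ - o + 1) / 2 : ℕ) : ℝ) ≤ Fintype.card V := by
    exact_mod_cast (by omega : (ℓ - o + 1) / 2 ≤ Fintype.card V)
  have hn : (1 : ℝ) ≤ Fintype.card V := by
    exact_mod_cast (by omega : 1 ≤ Fintype.card V)
  have hb := hsp.bound hF hS hs hn hcard'
    (endDamped_of_killed hS hs hn _ (hmem 0 (by omega)) (by
      rw [zero_add]
      refine hseq.left_end hF fun h0 k hk => ?_
      rcases seqEdges_nbr (hinjC 0 (by omega) h0) hk with h | h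
      · omega
      · exact h.2))
    (endDamped_of_killed hS hs hn _ (hmem _ (by omega)) (by
      refine hseq.right_end hF fun h0 k hk => ?_
      rcases seqEdges_nbr (hinjC ℓ le_rfl h0) hk with h | h
      · exact h.2
      · omega))
  intro i hi
  obtain ⟨j, hj, he, hij⟩ := hmatched i hi
  obtain ⟨h1, h2⟩ := hseq.index hj he
  rcases hij with rfl | rfl
  · have := hb (j - o) (by omega)
    simpa only [show j - o + o = j by omega] using this
  · have := hb (j + 1 - o) h2
    simpa only [show j + 1 - o + o = j + 1 by omega] using this

theorem IsStem.injective {r : ℕ → V} {a : ℕ} (h : IsStem M r a) {j : ℕ} (hj : j ≤ a) :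
    ∀ i ≤ a, r j = r i → j = i := fun _ hi he =>
  h.2.1 (Set.mem_Iic.2 hj) (Set.mem_Iic.2 hi) he

theorem IsOddCycle.card_le [Fintype V] {c : ℕ → V} {b : ℕ} (h : IsOddCycle M c b) :
    b ≤ Fintype.card V :=
  le_card_of_injective_below (f := c) fun _ hi _ hj he =>
    h.2.2.2.1 (Set.mem_Iio.2 hi) (Set.mem_Iio.2 hj) he

/-- The bound along an odd cycle whose base belongs to a spine that is already bounded. -/
theorem IsEndCycle.bound_of_spine {c : ℕ → V} {b : ℕ} {e e' : V} (h : IsEndCycle M E c b e e')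
    (hF : IsFrame M C E) (hS : IsStatic M C E x ε s) (hs : 0 ≤ s) (hn : (b : ℝ) ≤ n)
    (he : e ∈ C) (h1 : |x e| ≤ ε + 10 * n ^ 2 * s) (h2 : |x e'| ≤ ε + 10 * n ^ 2 * s) (j : ℕ)
    (h0 : 0 < j) (hj : j < b) : |x (c j)| ≤ ε + 13 * n ^ 2 * s := by
  have : 0 ≤ 10 * n ^ 2 * s := by positivity
  have := h.bound hF hS hs hn he (a := ε + 10 * n ^ 2 * s) (by linarith) h1 h2 j h0 hj
  linarith

/-- The stem is a spine damped at one end by the odd cycle and absorbed at the other; once it is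
bounded, the maximum principle bounds the cycle. -/
theorem IsBlossom.bound [Fintype V] (hF : IsFrame M C E) (hS : IsStatic M C E x ε s)
    (hs : 0 ≤ s) (hε : 0 ≤ ε) (hT : IsBlossom M E) :
    ∀ i ∈ C, |x i| ≤ ε + 13 * (Fintype.card V : ℝ) ^ 2 * s := by
  obtain ⟨a, b, r, c, hr, hc, h0, hrc, rfl⟩ := hT
  have hrne : ∀ j, 0 < j → j ≤ a → ∀ i ≤ b, r j ≠ c i := fun j hj hja =>
    hc.ne_of_lt fun i hi he => by
      have := (hrc j hja i hi he).1; omega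
  have ha := hr.1
  have hseq : IsAltSeq M (seqEdges r a ∪ seqEdges c b) r a 0 := by
    refine ⟨by omega, ha, fun j hj => Or.inl ⟨j, hj, rfl⟩, hr.2.2, ?_⟩
    intro j hj hja k hk
    rcases hk with hk | hk
    · rcases seqEdges_nbr (hr.injective hja.le) hk with h | h
      · exact Or.inl h.2
      · exact Or.inr h.2
    · exact absurd hk (not_mem_seqEdges (hrne j hj hja.le) k)
  have hr01 : M.Adj (r 0) (r 1) := (hr.2.2 0 ha).2 (by simp)
  have hcyc : IsEndCycle M (seqEdges r a ∪ seqEdges c b) c b (r 0) (r 1) := by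
    refine ⟨hc, h0, hr01, fun j hj => Or.inr ⟨j, hj, rfl⟩, ?_, ?_⟩
    · intro j hj hjb k hk
      rcases hk with hk | hk
      · refine absurd hk (not_mem_seqEdges (fun i hi he => ?_) k)
        have := (hrc i hi j hjb he.symm).2; omega
      · exact hc.nbr hj hjb hk
    · intro k hk hk'
      rcases hk with hk | hk
      · rcases seqEdges_nbr (hr.injective (Nat.zero_le a)) hk with h | h
        · omega
        · exact absurd (h.2 ▸ hr01) hk'
      · rw [← h0] at hk
        exact hc.base_nbr hk
  have hsp := hseq.isSpine
  have hmem := hsp.mem hF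
  simp only [add_zero, tsub_zero] at hsp hmem
  have hcard : a + 1 ≤ Fintype.card V :=
    le_card_of_injective_below (f := r) fun i hi j hj he =>
      hr.injective (by omega) j (by omega) he
  have hcard' : (((a + 1) / 2 : ℕ) : ℝ) ≤ Fintype.card V := by
    exact_mod_cast (by omega : (a + 1) / 2 ≤ Fintype.card V)
  have hn : (1 : ℝ) ≤ Fintype.card V := by
    exact_mod_cast (by omega : 1 ≤ Fintype.card V)
  have hbn : (b : ℝ) ≤ Fintype.card V := by exact_mod_cast hc.card_le
  have hb := hsp.bound hF hS hs hn hcard'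
    (hcyc.endDamped hF hS hs hε hbn (hmem 0 (by omega)))
    (endDamped_of_killed hS hs hn _ (hmem _ (by omega)) (by
      have := hseq.right_end hF fun _ k hk => ?_
      · simpa only [add_zero, tsub_zero] using this
      · rcases hk with hk | hk
        · rcases seqEdges_nbr (hr.injective le_rfl) hk with h | h
          · exact h.2
          · omega
        · exact absurd hk (not_mem_seqEdges (hrne a ha le_rfl) k)))
  have hb' := hcyc.bound_of_spine hF hS hs hbn (hmem 0 (by omega)) (hb 0 (by omega))
    (hb 1 (by omega))
  have hle : ε + 10 * (Fintype.card V : ℝ) ^ 2 * s ≤ ε + 13 * (Fintype.card V : ℝ) ^ 2 * s := by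
    gcongr; norm_num
  intro i hi
  obtain ⟨q, hq⟩ := hF.exists_partner i hi
  rcases hF.edge_mem i q hq hi with hE | hE
  · obtain ⟨j, hj, ⟨rfl, rfl⟩ | ⟨rfl, rfl⟩⟩ := mem_seqEdges hE
    · obtain ⟨d, hd⟩ := (hr.2.2 j hj).1 hq
      exact (hb j (by omega)).trans hle
    · obtain ⟨d, hd⟩ := (hr.2.2 j hj).1 hq.symm
      exact (hb (j + 1) (by omega)).trans hle
  · obtain ⟨-, ⟨m, hm⟩, -, -, halt⟩ := hc
    obtain ⟨j, hj, ⟨rfl, rfl⟩ | ⟨rfl, rfl⟩⟩ := mem_seqEdges hE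
    · obtain ⟨d, hd⟩ := (halt j hj).1 hq
      exact hb' j (by omega) (by omega)
    · obtain ⟨d, hd⟩ := (halt j hj).1 hq.symm
      exact hb' (j + 1) (by omega) (by omega)

/-- As for a blossom, with the joining path damped by an odd cycle at both ends. -/
theorem IsBicycle.bound [Fintype V] (hF : IsFrame M C E) (hS : IsStatic M C E x ε s)
    (hs : 0 ≤ s) (hε : 0 ≤ ε) (hT : IsBicycle M E) :
    ∀ i ∈ C, |x i| ≤ ε + 13 * (Fintype.card V : ℝ) ^ 2 * s := by
  obtain ⟨a, b, b', r, c, c', hr, hao, hc, hc', h0, h0', hrc, hrc', hcc, rfl⟩ := hT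
  have hcc' : ∀ i < b, ∀ j ≤ b', c i ≠ c' j := fun i hi =>
    hc'.ne_of_lt fun j hj => hcc i hi j hj
  have hcc'' : ∀ j < b', ∀ i ≤ b, c' j ≠ c i := fun j hj =>
    hc.ne_of_lt fun i hi he => hcc i hi j hj he.symm
  have hrne : ∀ j, 0 < j → j ≤ a → ∀ i ≤ b, r j ≠ c i := fun j hj hja =>
    hc.ne_of_lt fun i hi he => by
      have := (hrc j hja i hi he).1; omega
  have hrne' : ∀ j < a, ∀ i ≤ b', r j ≠ c' i := fun j hj =>
    hc'.ne_of_lt fun i hi he => by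
      have := (hrc' j hj.le i hi he).1; omega
  have ha := hr.1
  set E := seqEdges r a ∪ seqEdges c b ∪ seqEdges c' b' with hE
  have hseq : IsAltSeq M E r a 0 := by
    refine ⟨by omega, ha, fun j hj => Or.inl (Or.inl ⟨j, hj, rfl⟩), hr.2.2, ?_⟩
    intro j hj hja k hk
    rcases hk with (hk | hk) | hk
    · rcases seqEdges_nbr (hr.injective hja.le) hk with h | h
      · exact Or.inl h.2
      · exact Or.inr h.2
    · exact absurd hk (not_mem_seqEdges (hrne j hj hja.le) k)
    · exact absurd hk (not_mem_seqEdges (hrne' j hja) k)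
  obtain ⟨m, hm⟩ := hao
  have hr01 : M.Adj (r 0) (r 1) := (hr.2.2 0 ha).2 (by simp)
  have hra : M.Adj (r (a - 1)) (r a) := by
    have := (hr.2.2 (a - 1) (by omega)).2 ⟨m, by omega⟩
    rwa [show a - 1 + 1 = a by omega] at this
  have hcyc : IsEndCycle M E c b (r 0) (r 1) := by
    refine ⟨hc, h0, hr01, fun j hj => Or.inl (Or.inr ⟨j, hj, rfl⟩), ?_, ?_⟩
    · intro j hj hjb k hk
      rcases hk with (hk | hk) | hk
      · refine absurd hk (not_mem_seqEdges (fun i hi he => ?_) k)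
        have := (hrc i hi j hjb he.symm).2; omega
      · exact hc.nbr hj hjb hk
      · exact absurd hk (not_mem_seqEdges (hcc' j hjb) k)
    · intro k hk hk'
      rcases hk with (hk | hk) | hk
      · rcases seqEdges_nbr (hr.injective (Nat.zero_le a)) hk with h | h
        · omega
        · exact absurd (h.2 ▸ hr01) hk'
      · rw [← h0] at hk
        exact hc.base_nbr hk
      · exact absurd hk (not_mem_seqEdges (hrne' 0 ha) k)
  have hcyc' : IsEndCycle M E c' b' (r a) (r (a - 1)) := by
    refine ⟨hc', h0', hra.symm, fun j hj => Or.inr ⟨j, hj, rfl⟩, ?_, ?_⟩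
    · intro j hj hjb k hk
      rcases hk with (hk | hk) | hk
      · refine absurd hk (not_mem_seqEdges (fun i hi he => ?_) k)
        have := (hrc' i hi j hjb he.symm).2; omega
      · exact absurd hk (not_mem_seqEdges (hcc'' j hjb) k)
      · exact hc'.nbr hj hjb hk
    · intro k hk hk'
      rcases hk with (hk | hk) | hk
      · rcases seqEdges_nbr (hr.injective le_rfl) hk with h | h
        · exact absurd (h.2 ▸ hra.symm) hk'
        · omega
      · exact absurd hk (not_mem_seqEdges (hrne a ha le_rfl) k)
      · rw [← h0'] at hk
        exact hc'.base_nbr hk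
  have hsp := hseq.isSpine
  have hmem := hsp.mem hF
  simp only [add_zero, tsub_zero] at hsp hmem
  have hcard : a + 1 ≤ Fintype.card V :=
    le_card_of_injective_below (f := r) fun i hi j hj he =>
      hr.injective (by omega) j (by omega) he
  have hcard' : (((a + 1) / 2 : ℕ) : ℝ) ≤ Fintype.card V := by
    exact_mod_cast (by omega : (a + 1) / 2 ≤ Fintype.card V)
  have hn : (1 : ℝ) ≤ Fintype.card V := by
    exact_mod_cast (by omega : 1 ≤ Fintype.card V)
  have hbn : (b : ℝ) ≤ Fintype.card V := by exact_mod_cast hc.card_le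
  have hbn' : (b' : ℝ) ≤ Fintype.card V := by exact_mod_cast hc'.card_le
  have hb := hsp.bound hF hS hs hn hcard'
    (hcyc.endDamped hF hS hs hε hbn (hmem 0 (by omega)))
    (by
      rw [show 2 * ((a + 1) / 2 - 1) + 1 = a by omega,
        show 2 * ((a + 1) / 2 - 1) = a - 1 by omega]
      exact hcyc'.endDamped hF hS hs hε hbn' (hmem a (by omega)))
  have hb1 := hcyc.bound_of_spine hF hS hs hbn (hmem 0 (by omega)) (hb 0 (by omega))
    (hb 1 (by omega))
  have hb2 := hcyc'.bound_of_spine hF hS hs hbn' (hmem a (by omega)) (hb a (by omega))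
    (hb (a - 1) (by omega))
  have hle : ε + 10 * (Fintype.card V : ℝ) ^ 2 * s ≤ ε + 13 * (Fintype.card V : ℝ) ^ 2 * s := by
    gcongr; norm_num
  intro i hi
  obtain ⟨q, hq⟩ := hF.exists_partner i hi
  rcases hF.edge_mem i q hq hi with (hE | hE) | hE
  · obtain ⟨j, hj, ⟨rfl, rfl⟩ | ⟨rfl, rfl⟩⟩ := mem_seqEdges hE
    · exact (hb j (by omega)).trans hle
    · exact (hb (j + 1) (by omega)).trans hle
  · obtain ⟨-, ⟨m, hm⟩, -, -, halt⟩ := hc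
    obtain ⟨j, hj, ⟨rfl, rfl⟩ | ⟨rfl, rfl⟩⟩ := mem_seqEdges hE
    · obtain ⟨d, hd⟩ := (halt j hj).1 hq
      exact hb1 j (by omega) (by omega)
    · obtain ⟨d, hd⟩ := (halt j hj).1 hq.symm
      exact hb1 (j + 1) (by omega) (by omega)
  · obtain ⟨-, ⟨m, hm⟩, -, -, halt⟩ := hc'
    obtain ⟨j, hj, ⟨rfl, rfl⟩ | ⟨rfl, rfl⟩⟩ := mem_seqEdges hE
    · obtain ⟨d, hd⟩ := (halt j hj).1 hq
      exact hb2 j (by omega) (by omega)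
    · obtain ⟨d, hd⟩ := (halt j hj).1 hq.symm
      exact hb2 (j + 1) (by omega) (by omega)

end Structures

/-! ### Offers, best offers and alternatives -/

section Offers

variable {V : Type u} {G : SimpleGraph V} {w : Sym2 V → ℝ}

theorem abs_iSup_sub_iSup_le {ι : Type*} [Finite ι] {f g : ι → ℝ} {c : ℝ} (hc : 0 ≤ c)
    (h : ∀ i, |f i - g i| ≤ c) : |(⨆ i, f i) - ⨆ i, g i| ≤ c := by
  rcases isEmpty_or_nonempty ι with _ | _
  · simpa using hc
  have hf := Set.finite_range f
  have hg := Set.finite_range g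
  rw [abs_sub_le_iff]
  constructor
  · rw [sub_le_iff_le_add]
    refine ciSup_le fun i => ?_
    linarith [le_ciSup hg.bddAbove i, (abs_sub_le_iff.1 (h i)).1]
  · rw [sub_le_iff_le_add]
    refine ciSup_le fun i => ?_
    linarith [le_ciSup hf.bddAbove i, (abs_sub_le_iff.1 (h i)).2]

/-- The largest offer to the tail of `d` from the neighbours other than the head of `d`. -/
noncomputable def bestOffer (G : SimpleGraph V) (w : Sym2 V → ℝ) (α : G.Dart → ℝ) (d : G.Dart) :
    ℝ :=
  ⨆ e : {e : G.Dart // e.snd = d.fst ∧ e.fst ≠ d.snd}, offer G w α e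

theorem step_eq_averaged (κ : ℝ) : step G w κ = averaged κ (bestOffer G w) := rfl

/-- On each linear piece, the coefficients of the two messages have absolute values of sum at most
1. This is what makes the best-offer map nonexpansive. -/
theorem offer_lipschitz {α β : G.Dart → ℝ} {d : G.Dart} {c : ℝ} (h1 : |α d - β d| ≤ c)
    (h2 : |α d.symm - β d.symm| ≤ c) : |offer G w α d - offer G w β d| ≤ c := by
  simp only [offer, posPart_def]
  generalize α d = a at *
  generalize α d.symm = a' at *
  generalize β d = b at *
  generalize β d.symm = b' at *
  generalize w d.edge = W
  rw [abs_le] at *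
  rcases max_cases (W - a) 0 with ⟨e1, f1⟩ | ⟨e1, f1⟩ <;>
  rcases max_cases (W - a - a') 0 with ⟨e2, f2⟩ | ⟨e2, f2⟩ <;>
  rcases max_cases (W - b) 0 with ⟨e3, f3⟩ | ⟨e3, f3⟩ <;>
  rcases max_cases (W - b - b') 0 with ⟨e4, f4⟩ | ⟨e4, f4⟩ <;>
  rw [e1, e2, e3, e4] <;> constructor <;> linarith

theorem offer_le {α : G.Dart → ℝ} (d : G.Dart) : offer G w α d ≤ (w d.edge - α d)⁺ := by
  have := posPart_nonneg (w d.edge - α d - α d.symm)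
  simp only [offer]; linarith

theorem offer_nonneg {α : G.Dart → ℝ} (hα : ∀ d, 0 ≤ α d) (d : G.Dart) : 0 ≤ offer G w α d := by
  have h := hα d.symm
  simp only [offer, posPart_def]
  rcases max_cases (w d.edge - α d) 0 with ⟨e1, f1⟩ | ⟨e1, f1⟩ <;>
  rcases max_cases (w d.edge - α d - α d.symm) 0 with ⟨e2, f2⟩ | ⟨e2, f2⟩ <;>
  rw [e1, e2] <;> linarith

theorem offer_eq_of_le {α : G.Dart → ℝ} {d : G.Dart} (h : w d.edge ≤ α d + α d.symm) :
    offer G w α d = (w d.edge - α d)⁺ := by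
  simp only [offer]
  rw [posPart_eq_zero.2 (by linarith : w d.edge - α d - α d.symm ≤ 0)]
  ring

theorem offer_eq_of_ge {α : G.Dart → ℝ} {d : G.Dart} (h0 : 0 ≤ α d.symm)
    (h : α d + α d.symm ≤ w d.edge) :
    offer G w α d = (w d.edge - α d + α d.symm) / 2 := by
  simp only [offer]
  rw [posPart_eq_self.2 (by linarith : 0 ≤ w d.edge - α d - α d.symm),
    posPart_eq_self.2 (by linarith : 0 ≤ w d.edge - α d)]
  ring

instance [Finite V] : Finite G.Dart :=
  Finite.of_injective (fun d : G.Dart => d.toProd) SimpleGraph.Dart.toProd_injective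

theorem offer_le_bestOffer [Finite V] {α : G.Dart → ℝ} {d e : G.Dart} (h1 : e.snd = d.fst)
    (h2 : e.fst ≠ d.snd) : offer G w α e ≤ bestOffer G w α d :=
  le_ciSup (f := fun e : {e : G.Dart // e.snd = d.fst ∧ e.fst ≠ d.snd} => offer G w α e)
    (Set.finite_range _).bddAbove ⟨e, h1, h2⟩

theorem bestOffer_le {α : G.Dart → ℝ} {d : G.Dart} {c : ℝ} (hc : 0 ≤ c)
    (h : ∀ e : G.Dart, e.snd = d.fst → e.fst ≠ d.snd → offer G w α e ≤ c) :
    bestOffer G w α d ≤ c :=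
  Real.iSup_le (fun e => h e e.2.1 e.2.2) hc

theorem bestOffer_nonneg {α : G.Dart → ℝ} (hα : ∀ d, 0 ≤ α d) (d : G.Dart) :
    0 ≤ bestOffer G w α d :=
  Real.iSup_nonneg fun e => offer_nonneg hα e

theorem exists_offer_eq_bestOffer [Finite V] {α : G.Dart → ℝ} {d : G.Dart}
    (h : 0 < bestOffer G w α d) :
    ∃ e : G.Dart, e.snd = d.fst ∧ e.fst ≠ d.snd ∧ offer G w α e = bestOffer G w α d := by
  unfold bestOffer at h ⊢
  rcases isEmpty_or_nonempty {e : G.Dart // e.snd = d.fst ∧ e.fst ≠ d.snd} with _ | _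
  · simp at h
  · obtain ⟨e, he⟩ := exists_eq_ciSup_of_finite
      (f := fun e : {e : G.Dart // e.snd = d.fst ∧ e.fst ≠ d.snd} => offer G w α e)
    exact ⟨e, e.2.1, e.2.2, he⟩

theorem bestOffer_lipschitz [Finite V] {α β : G.Dart → ℝ} {c : ℝ} (hc : 0 ≤ c)
    (h : ∀ d, |α d - β d| ≤ c) (d : G.Dart) : |bestOffer G w α d - bestOffer G w β d| ≤ c :=
  abs_iSup_sub_iSup_le hc fun e => offer_lipschitz (h e) (h _)

theorem offer_le_earning [Finite V] {α : G.Dart → ℝ} (e : G.Dart) :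
    offer G w α e ≤ earning G w α e.snd :=
  le_ciSup (f := fun e' : {e' : G.Dart // e'.snd = e.snd} => offer G w α e')
    (Set.finite_range _).bddAbove ⟨e, rfl⟩

theorem exists_offer_eq_earning [Finite V] {α : G.Dart → ℝ} {i : V}
    (h : 0 < earning G w α i) : ∃ e : G.Dart, e.snd = i ∧ offer G w α e = earning G w α i := by
  unfold earning at h ⊢
  rcases isEmpty_or_nonempty {e : G.Dart // e.snd = i} with _ | _
  · simp at h
  · obtain ⟨e, he⟩ := exists_eq_ciSup_of_finite
      (f := fun e : {e : G.Dart // e.snd = i} => offer G w α e)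
    exact ⟨e, e.2, he⟩

theorem alternative_nonneg (γ : V → ℝ) (i j : V) : 0 ≤ alternative G w γ i j :=
  Real.iSup_nonneg fun _ => posPart_nonneg _

theorem le_alternative [Finite V] {γ : V → ℝ} {i j k : V} (h : G.Adj i k) (hk : k ≠ j) :
    (w s(i, k) - γ k)⁺ ≤ alternative G w γ i j :=
  le_ciSup (f := fun k : {k : V // G.Adj i k ∧ k ≠ j} => (w s(i, (k : V)) - γ k)⁺)
    (Set.finite_range _).bddAbove ⟨k, h, hk⟩

theorem alternative_le {γ : V → ℝ} {i j : V} {c : ℝ} (hc : 0 ≤ c)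
    (h : ∀ k, G.Adj i k → k ≠ j → (w s(i, k) - γ k)⁺ ≤ c) : alternative G w γ i j ≤ c :=
  Real.iSup_le (fun k => h k k.2.1 k.2.2) hc

theorem exists_eq_alternative [Finite V] {γ : V → ℝ} {i j : V}
    (h : 0 < alternative G w γ i j) :
    ∃ k, G.Adj i k ∧ k ≠ j ∧ w s(i, k) - γ k = alternative G w γ i j := by
  unfold alternative at h ⊢
  rcases isEmpty_or_nonempty {k : V // G.Adj i k ∧ k ≠ j} with _ | _
  · simp at h
  · obtain ⟨k, hk⟩ := exists_eq_ciSup_of_finite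
      (f := fun k : {k : V // G.Adj i k ∧ k ≠ j} => (w s(i, (k : V)) - γ k)⁺)
    refine ⟨k, k.2.1, k.2.2, ?_⟩
    rw [← hk] at h ⊢
    exact (posPart_eq_of_posPart_pos h).symm

theorem dart_edge (d : G.Dart) : d.edge = s(d.fst, d.snd) := rfl

end Offers

/-! ### Fixed points in terms of earnings -/

section FixedPoint

variable {V : Type u} {G : SimpleGraph V} {w : Sym2 V → ℝ} {M : G.Subgraph} {αs : G.Dart → ℝ}

theorem step_fixed_iff {κ : ℝ} (hκ : κ ≠ 0) {α : G.Dart → ℝ} :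
    step G w κ α = α ↔ bestOffer G w α = α := by
  rw [step_eq_averaged]
  constructor
  · intro h
    funext d
    have := congrFun h d
    simp only [averaged, Pi.add_apply, Pi.smul_apply, smul_eq_mul] at this
    have h2 : κ * (bestOffer G w α d - α d) = 0 := by linarith
    rcases mul_eq_zero.1 h2 with h3 | h3
    · exact absurd h3 hκ
    · linarith
  · exact averaged_fixed

variable [Finite V]

theorem message_le_earning (hα : ∀ d, 0 ≤ αs d) (hfix : bestOffer G w αs = αs) (d : G.Dart) :
    αs d ≤ earning G w αs d.fst := by
  rw [← congrFun hfix d]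
  refine bestOffer_le (Real.iSup_nonneg fun e => offer_nonneg hα e) fun e he _ => ?_
  rw [← he]
  exact offer_le_earning e

/-- At a fixed point, messages along unmatched edges are the earnings. -/
theorem message_eq_earning (hα : ∀ d, 0 ≤ αs d) (hfix : bestOffer G w αs = αs)
    (hN : IsNBSolution w M (earning G w αs)) (d : G.Dart) (hd : ¬ M.Adj d.fst d.snd) :
    αs d = earning G w αs d.fst := by
  refine le_antisymm (message_le_earning hα hfix d) ?_
  by_contra hlt
  push Not at hlt
  obtain ⟨e, he, hee⟩ := exists_offer_eq_earning ((hα d).trans_lt hlt)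
  -- If the message were smaller than the earnings, the best offer to i would come only from the
  -- head of d. It then counts as an alternative to the partner p, so the message from i to p equals
  -- the earnings of i. This forces p to offer at least these earnings, and that offer enters the
  -- message along d: a contradiction.
  have hfst : e.fst = d.snd := by
    by_contra hne
    have := offer_le_bestOffer (w := w) (α := αs) he hne
    rw [hfix, hee] at this
    linarith
  have hi : d.fst ∈ M.verts := by
    by_contra hi
    have := hN.unmatched _ hi
    linarith [hα d]
  obtain ⟨p, hp, -⟩ := hN.isMatching hi
  have hpd : p ≠ d.snd := fun h => hd (h ▸ hp)
  set dp : G.Dart := ⟨(d.fst, p), hp.adj_sub⟩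
  have h1 : earning G w αs d.fst ≤ αs dp := by
    rw [← congrFun hfix dp, ← hee]
    exact offer_le_bestOffer he (by rw [hfst]; exact hpd.symm)
  have h2 := message_le_earning hα hfix dp.symm
  have h3 := hN.trade _ _ hp
  have h4 : offer G w αs dp.symm ≤ αs d := by
    rw [← congrFun hfix d]
    exact offer_le_bestOffer rfl hpd
  have h5 := message_le_earning hα hfix dp
  have h6 : αs dp = earning G w αs d.fst := le_antisymm h5 h1
  have h0 := hN.nonneg d.fst
  have e1 : w dp.symm.edge = w s(d.fst, p) := by rw [SimpleGraph.Dart.edge_symm]; rfl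
  have h2' : αs dp.symm ≤ earning G w αs p := h2
  have h7 := offer_eq_of_ge (w := w) (α := αs) (d := dp.symm) (hα _) (by
    rw [SimpleGraph.Dart.symm_symm, h6, e1]; linarith)
  rw [SimpleGraph.Dart.symm_symm, h6, e1] at h7
  linarith

theorem offer_eq_of_not_adj (hα : ∀ d, 0 ≤ αs d) (hfix : bestOffer G w αs = αs)
    (hN : IsNBSolution w M (earning G w αs)) (d : G.Dart) (hd : ¬ M.Adj d.fst d.snd) :
    offer G w αs d = (w d.edge - earning G w αs d.fst)⁺ := by
  have hd' : ¬ M.Adj d.symm.fst d.symm.snd := fun h => hd h.symm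
  rw [offer_eq_of_le, message_eq_earning hα hfix hN d hd]
  rw [message_eq_earning hα hfix hN d hd, message_eq_earning hα hfix hN _ hd']
  exact hN.stable _ _ d.adj hd

/-- At a fixed point, messages along matching edges are the second-best offers. -/
theorem message_eq_alternative (hα : ∀ d, 0 ≤ αs d) (hfix : bestOffer G w αs = αs)
    (hN : IsNBSolution w M (earning G w αs)) (d : G.Dart) (hd : M.Adj d.fst d.snd) :
    αs d = alternative G w (earning G w αs) d.fst d.snd := by
  have hne : ∀ {k}, k ≠ d.snd → ¬ M.Adj k d.fst := fun hk h =>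
    hk (hN.isMatching.eq_of_adj_left h.symm hd)
  rw [← congrFun hfix d]
  apply le_antisymm
  · refine bestOffer_le (alternative_nonneg _ _ _) fun e he he' => ?_
    rw [offer_eq_of_not_adj hα hfix hN e (by rw [he]; exact hne he')]
    rw [dart_edge, he, Sym2.eq_swap]
    exact le_alternative (he ▸ e.adj.symm) he'
  · refine alternative_le (bestOffer_nonneg hα _) fun k hk hk' => ?_
    have := offer_eq_of_not_adj hα hfix hN ⟨(k, d.fst), hk.symm⟩ (hne hk')
    rw [dart_edge, Sym2.eq_swap] at this
    exact this.ge.trans (offer_le_bestOffer rfl hk')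

end FixedPoint

/-! ### Consequences of the gap for a single stage -/

section Stage

variable {V : Type u} {G : SimpleGraph V} {w : Sym2 V → ℝ} {M : G.Subgraph} {γ : V → ℝ}

/-- The properties of a stage of a Kleinberg-Tardos sequence with gap `σ > 0` which matter to the
dynamics. -/
structure IsGapStage (w : Sym2 V → ℝ) (M : G.Subgraph) (γ : V → ℝ) (F C : Set V) (s σ : ℝ) :
    Prop where
  gap_pos : 0 < σ
  gap_le : σ ≤ s
  isMatching : M.IsMatching
  nonempty : C.Nonempty
  unsettled : Disjoint C F
  exists_partner : ∀ i ∈ C, ∃ p, M.Adj i p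
  closed : ∀ i j, M.Adj i j → i ∈ C → j ∈ C
  slack : ∀ i ∈ C, ∀ p, M.Adj i p → γ i - alternative G w γ i p = s
  anchors : extNodes w M γ C ⊆ C ∪ F
  topology : IsAlternatingPath M C (edges w M γ C) ∨ IsBlossom M (edges w M γ C) ∨
    IsBicycle M (edges w M γ C) ∨
    (IsAlternatingCycle M (edges w M γ C) ∧ ∀ i ∈ C, s < γ i)
  edge_slack : ∀ i ∈ C, ∀ k, G.Adj i k → ¬ M.Adj i k → s ≤ γ i + γ k - w s(i, k)
  gap : ∀ i ∈ C, ∀ k, G.Adj i k → ¬ M.Adj i k → s(i, k) ∉ edges w M γ C → k ∉ F →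
    s + σ ≤ γ i + γ k - w s(i, k)

theorem mem_settledBefore {C : ℕ → Set V} {q : ℕ} {i : V} :
    i ∈ settledBefore M C q ↔ i ∉ M.verts ∨ ∃ p < q, i ∈ C p := by
  simp [settledBefore]

/-- The gap condition only concerns edges between endpoints of the structure. An edge to a node
settled in a later stage has at least the slack of that stage, by feasibility there, and this slack
is larger by σ or more. -/
theorem IsKTSequence.isGapStage {k : ℕ} {C : ℕ → Set V} {s : ℕ → ℝ} {σ : ℝ}
    (h : IsKTSequence w M γ k C s) (hN : IsNBSolution w M γ) (hσ : 0 < σ) (h0 : 0 < k → σ ≤ s 0)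
    (h1 : ∀ q, q + 1 < k → σ ≤ s (q + 1) - s q)
    (h2 : ∀ q < k, ∀ i ∈ C q, ∀ j ∈ extNodes w M γ (C q), G.Adj i j →
      s(i, j) ∉ edges w M γ (C q) → s q + σ ≤ γ i + γ j - w s(i, j)) :
    ∀ q < k, IsGapStage w M γ (settledBefore M C q) (C q) (s q) σ := by
  have hle : ∀ q < k, σ ≤ s q := by
    intro q
    induction q with
    | zero => exact h0
    | succ q ih => intro hq; linarith [ih (by omega), h1 q hq]
  have hlt : ∀ p q, p < q → q < k → s p + σ ≤ s q := by
    intro p q hpq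
    induction q, hpq using Nat.le_induction with
    | base => intro hq; linarith [h1 p hq]
    | succ q _ ih => intro hq; linarith [ih (by omega), h1 q hq]
  intro q hq
  have hst := h.1 q hq
  have hpartner : ∀ i ∈ C q, ∃ p, M.Adj i p := by
    intro i hi
    have : i ∈ M.verts := by
      by_contra hv
      exact Set.disjoint_left.1 hst.unsettled hi (mem_settledBefore.2 (Or.inl hv))
    exact (hN.isMatching this).exists
  refine ⟨hσ, hle q hq, hN.isMatching, hst.nonempty, hst.unsettled, hpartner, hst.trade_closed,
    hst.slack, hst.anchors, hst.topology, fun i hi j hij hM =>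
      hst.feasible.edge_slack i j hij hM fun hF => Set.disjoint_left.1 hst.unsettled hi hF.1, ?_⟩
  intro i hi j hij hM hE hj
  by_cases hjC : j ∈ C q
  · obtain ⟨p, hp⟩ := hpartner j hjC
    exact h2 q hq i hi j ⟨s(j, p), Or.inl ⟨j, hjC, p, hp, rfl⟩, Sym2.mem_mk_left _ _⟩ hij hE
  · have hall : j ∈ settledBefore M C k := h.2 ▸ Set.mem_univ j
    rw [mem_settledBefore] at hall hj
    push Not at hj
    obtain ⟨p, hpk, hp⟩ := hall.resolve_left (not_not.2 hj.1)
    have hqp : q < p := by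
      rcases lt_trichotomy p q with h' | rfl | h'
      · exact absurd hp (hj.2 p h')
      · exact absurd hp hjC
      · exact h'
    have hstp := h.1 p hpk
    have := hstp.feasible.edge_slack i j hij hM
      (fun hF => Set.disjoint_left.1 hstp.unsettled hp hF.2)
    linarith [hlt q p hqp hpk]

variable {F C : Set V} {s σ : ℝ}

theorem IsGapStage.isFrame (h : IsGapStage w M γ F C s σ) : IsFrame M C (edges w M γ C) := by
  refine ⟨h.isMatching, h.exists_partner, h.closed, fun i j hij hi => Or.inl ⟨i, hi, j, hij, rfl⟩,
    ?_⟩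
  rintro i j (⟨i', hi', j', hij', he⟩ | ⟨i', hi', p, j', -, -, -, -, -, he⟩) hij
  · rcases Sym2.eq_iff.1 he with ⟨rfl, rfl⟩ | ⟨rfl, rfl⟩
    · exact hi'
    · exact h.closed _ _ hij' hi'
  · rcases Sym2.eq_iff.1 he with ⟨rfl, rfl⟩ | ⟨rfl, rfl⟩
    · exact hi'
    · exact h.closed _ _ hij.symm hi'

/-- Along an unmatched edge of the structure, the offer is the second-best one. -/
theorem IsGapStage.edge_value (h : IsGapStage w M γ F C s σ) {i k : V}
    (hE : s(i, k) ∈ edges w M γ C) (hM : ¬ M.Adj i k) :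
    G.Adj i k ∧ w s(i, k) - γ k = γ i - s := by
  rcases hE with ⟨i', hi', j', hij', he⟩ | ⟨i', hi', p, j', hp, hadj, -, -, hval, he⟩
  · rcases Sym2.eq_iff.1 he with ⟨rfl, rfl⟩ | ⟨rfl, rfl⟩
    · exact absurd hij' hM
    · exact absurd hij'.symm hM
  · have hs := h.slack i' hi' p hp
    rcases Sym2.eq_iff.1 he with ⟨rfl, rfl⟩ | ⟨rfl, rfl⟩
    · exact ⟨hadj, by linarith⟩
    · rw [Sym2.eq_swap] at hval
      exact ⟨hadj.symm, by linarith⟩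

theorem IsGapStage.mem_or_mem (h : IsGapStage w M γ F C s σ) {i k : V}
    (hE : s(i, k) ∈ edges w M γ C) : k ∈ C ∨ k ∈ F :=
  h.anchors ⟨_, hE, Sym2.mem_mk_right _ _⟩

/-- A positive second-best offer is received along an edge of the structure. -/
theorem IsGapStage.exists_edge [Finite V] (h : IsGapStage w M γ F C s σ) {i p : V} (hi : i ∈ C)
    (hp : M.Adj i p) (hpos : 0 < alternative G w γ i p) :
    ∃ k, s(i, k) ∈ edges w M γ C ∧ ¬ M.Adj i k := by
  obtain ⟨k, hk, hkp, hval⟩ := exists_eq_alternative hpos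
  exact ⟨k, Or.inr ⟨i, hi, p, k, hp, hk, hkp, by linarith, hval, rfl⟩,
    fun hik => hkp (h.isMatching.eq_of_adj_left hik hp)⟩

end Stage

/-! ### Linearisation near the fixed point -/

section Local

variable {V : Type u} {G : SimpleGraph V} {w : Sym2 V → ℝ} {M : G.Subgraph}
  {αs α : G.Dart → ℝ} {F C : Set V} {s σ Δ η ε : ℝ}

open Classical in
/-- The deviation of the message from `i` to its trading partner. -/
noncomputable def nodeDev (M : G.Subgraph) (α αs : G.Dart → ℝ) (i : V) : ℝ :=
  if h : ∃ p, M.Adj i p then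
    α ⟨(i, h.choose), h.choose_spec.adj_sub⟩ - αs ⟨(i, h.choose), h.choose_spec.adj_sub⟩
  else 0

theorem nodeDev_eq (hM : M.IsMatching) (d : G.Dart) (hd : M.Adj d.fst d.snd) :
    nodeDev M α αs d.fst = α d - αs d := by
  have h : ∃ p, M.Adj d.fst p := ⟨_, hd⟩
  have h2 : (⟨(d.fst, h.choose), h.choose_spec.adj_sub⟩ : G.Dart) = d := by
    apply SimpleGraph.Dart.ext
    exact Prod.ext rfl (hM.eq_of_adj_left h.choose_spec hd)
  rw [nodeDev, dif_pos h, h2]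

/-- The situation in which the dynamics is analysed: `αs` is a fixed point with a Nash bargaining
solution, and `α` is a message vector at distance at most `Δ` of it. -/
structure IsNear (w : Sym2 V → ℝ) (M : G.Subgraph) (αs α : G.Dart → ℝ) (Δ : ℝ) : Prop where
  nonneg_fixed : ∀ d, 0 ≤ αs d
  fixed : bestOffer G w αs = αs
  solution : IsNBSolution w M (earning G w αs)
  nonneg : ∀ d, 0 ≤ α d
  near : ∀ d, |α d - αs d| ≤ Δ

theorem IsNear.message_eq [Finite V] (h : IsNear w M αs α Δ) (d : G.Dart)
    (hd : ¬ M.Adj d.fst d.snd) : αs d = earning G w αs d.fst :=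
  message_eq_earning h.nonneg_fixed h.fixed h.solution d hd

theorem IsNear.matched_message_eq [Finite V] (h : IsNear w M αs α Δ)
    (hC : IsGapStage w M (earning G w αs) F C s σ) (d : G.Dart) (hd : M.Adj d.fst d.snd)
    (hi : d.fst ∈ C) : αs d = earning G w αs d.fst - s := by
  rw [message_eq_alternative h.nonneg_fixed h.fixed h.solution d hd]
  linarith [hC.slack _ hi _ hd]

/-- At the fixed point each message on a matching edge of the stage is s below the earnings, so the
surplus is 2 s. As 2 Δ ≤ σ ≤ s it stays nonnegative, and the offer stays on its linear branch. -/
theorem IsNear.partner_offer [Finite V] (h : IsNear w M αs α Δ)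
    (hC : IsGapStage w M (earning G w αs) F C s σ) (hΔ : 2 * Δ ≤ σ) (d : G.Dart)
    (hd : M.Adj d.fst d.snd) (hi : d.snd ∈ C) :
    offer G w α d =
      earning G w αs d.snd + (nodeDev M α αs d.snd - nodeDev M α αs d.fst) / 2 := by
  have h1 := h.matched_message_eq hC d hd (hC.closed _ _ hd.symm hi)
  have h2 := h.matched_message_eq hC d.symm hd.symm hi
  have h3 := h.solution.trade _ _ hd
  have h4 := nodeDev_eq (α := α) (αs := αs) h.solution.isMatching d hd
  have h5 := nodeDev_eq (α := α) (αs := αs) h.solution.isMatching d.symm hd.symm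
  have h6 := abs_le.1 (h.near d)
  have h7 := abs_le.1 (h.near d.symm)
  have h8 := hC.gap_le
  change αs d.symm = earning G w αs d.snd - s at h2
  change nodeDev M α αs d.snd = _ at h5
  rw [← dart_edge] at h3
  rw [offer_eq_of_ge (h.nonneg _) (by linarith), h4, h5]
  linarith

theorem IsNear.other_offer_le [Finite V] (h : IsNear w M αs α Δ)
    (hC : IsGapStage w M (earning G w αs) F C s σ) {i p : V} (hi : i ∈ C) (hp : M.Adj i p)
    (e : G.Dart) (he : e.snd = i) (hep : e.fst ≠ p) :
    offer G w α e ≤ earning G w αs i - s + Δ := by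
  subst he
  have hne : ¬ M.Adj e.fst e.snd := fun h' => hep (hC.isMatching.eq_of_adj_left h'.symm hp)
  have h1 := h.message_eq e hne
  have h2 := abs_le.1 (h.near e)
  have h3 := le_alternative (w := w) (γ := earning G w αs) e.adj.symm hep
  have h4 := hC.slack _ hi _ hp
  have h5 := alternative_nonneg (G := G) (w := w) (earning G w αs) e.snd p
  rw [Sym2.eq_swap, ← dart_edge] at h3
  refine (offer_le e).trans ?_
  have h6 := le_posPart (w e.edge - earning G w αs e.fst)
  rw [posPart_def]
  exact max_le (by linarith) (by linarith [h2.1])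

/-- The partner offers at least γ i - Δ and everyone else at most γ i - s + Δ, with 2 Δ ≤ s, so the
best offer remains that of the partner. -/
theorem IsNear.bestOffer_eq [Finite V] (h : IsNear w M αs α Δ)
    (hC : IsGapStage w M (earning G w αs) F C s σ) (hΔ : 2 * Δ ≤ σ) (d : G.Dart) {p : V}
    (hp : M.Adj d.fst p) (hpd : p ≠ d.snd) (hi : d.fst ∈ C) :
    bestOffer G w α d =
      earning G w αs d.fst + (nodeDev M α αs d.fst - nodeDev M α αs p) / 2 := by
  have hoff := h.partner_offer hC hΔ ⟨(p, d.fst), hp.adj_sub.symm⟩ hp.symm hi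
  change _ = earning G w αs d.fst + (nodeDev M α αs d.fst - nodeDev M α αs p) / 2 at hoff
  have h4 := nodeDev_eq (α := α) (αs := αs) h.solution.isMatching ⟨(d.fst, p), hp.adj_sub⟩ hp
  have h5 := nodeDev_eq (α := α) (αs := αs) h.solution.isMatching ⟨(p, d.fst), hp.adj_sub.symm⟩
    hp.symm
  have h6 := abs_le.1 (h4 ▸ h.near ⟨(d.fst, p), hp.adj_sub⟩)
  have h7 := abs_le.1 (h5 ▸ h.near ⟨(p, d.fst), hp.adj_sub.symm⟩)
  change -Δ ≤ nodeDev M α αs d.fst ∧ nodeDev M α αs d.fst ≤ Δ at h6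
  change -Δ ≤ nodeDev M α αs p ∧ nodeDev M α αs p ≤ Δ at h7
  have hoff0 := offer_nonneg (w := w) h.nonneg ⟨(p, d.fst), hp.adj_sub.symm⟩
  apply le_antisymm
  · refine bestOffer_le (by linarith) fun e he he' => ?_
    by_cases hep : e.fst = p
    · have : e = ⟨(p, d.fst), hp.adj_sub.symm⟩ :=
        SimpleGraph.Dart.ext _ _ (Prod.ext hep he)
      rw [this, hoff]
    · have := h.other_offer_le hC hi hp e he hep
      linarith [hC.gap_le]
  · rw [← hoff]
    exact offer_le_bestOffer rfl hpd

/-- The offer along an unmatched edge of the structure. -/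
theorem IsNear.edge_offer [Finite V] (h : IsNear w M αs α Δ)
    (hC : IsGapStage w M (earning G w αs) F C s σ) (hΔ : 2 * Δ ≤ σ) (e : G.Dart)
    (hM : ¬ M.Adj e.snd e.fst)
    (hE : s(e.snd, e.fst) ∈ edges w M (earning G w αs) C) :
    offer G w α e = (earning G w αs e.snd - s - (α e - αs e))⁺ := by
  obtain ⟨-, hval⟩ := hC.edge_value hE hM
  have hne : ¬ M.Adj e.fst e.snd := fun h' => hM h'.symm
  rw [Sym2.eq_swap, ← dart_edge] at hval
  have h1 := h.message_eq e hne
  have h2 := h.message_eq e.symm hM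
  change αs e.symm = earning G w αs e.snd at h2
  have h6 := abs_le.1 (h.near e)
  have h7 := abs_le.1 (h.near e.symm)
  rw [offer_eq_of_le (by linarith [hC.gap_le])]
  congr 1
  linarith

theorem IsNear.nodeDev_ge [Finite V] (h : IsNear w M αs α Δ)
    (hC : IsGapStage w M (earning G w αs) F C s σ) (hΔ : 2 * Δ ≤ σ)
    (hη : ∀ d, |bestOffer G w α d - α d| ≤ η) (e : G.Dart) (hi : e.snd ∈ C)
    (hM : ¬ M.Adj e.snd e.fst) (hE : s(e.snd, e.fst) ∈ edges w M (earning G w αs) C) :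
    -(α e - αs e) - η ≤ nodeDev M α αs e.snd := by
  obtain ⟨p, hp⟩ := hC.exists_partner _ hi
  have hep : e.fst ≠ p := fun h' => hM (h' ▸ hp)
  have h1 := offer_le_bestOffer (w := w) (α := α) (d := ⟨(e.snd, p), hp.adj_sub⟩) (e := e) rfl hep
  have h2 := abs_le.1 (hη ⟨(e.snd, p), hp.adj_sub⟩)
  have h3 := h.edge_offer hC hΔ e hM hE
  have h4 := le_posPart (earning G w αs e.snd - s - (α e - αs e))
  have h5 := h.matched_message_eq hC ⟨(e.snd, p), hp.adj_sub⟩ hp hi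
  have h6 := nodeDev_eq (α := α) (αs := αs) h.solution.isMatching ⟨(e.snd, p), hp.adj_sub⟩ hp
  change αs _ = earning G w αs e.snd - s at h5
  change nodeDev M α αs e.snd = _ at h6
  linarith

theorem IsNear.unmatched_dev [Finite V] (h : IsNear w M αs α Δ)
    (hC : IsGapStage w M (earning G w αs) F C s σ) (hΔ : 2 * Δ ≤ σ)
    (hη : ∀ d, |bestOffer G w α d - α d| ≤ η) (d : G.Dart) {p : V} (hp : M.Adj d.fst p)
    (hpd : p ≠ d.snd) (hi : d.fst ∈ C) :
    |α d - αs d - (nodeDev M α αs d.fst - nodeDev M α αs p) / 2| ≤ η := by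
  have h1 := h.bestOffer_eq hC hΔ d hp hpd hi
  have h2 := abs_le.1 (hη d)
  rw [h.message_eq d fun h' => hpd (hC.isMatching.eq_of_adj_left hp h')]
  rw [abs_le]
  constructor <;> linarith

/-- Near the fixed point, approximate fixed points satisfy the static relations. -/
theorem IsNear.isStatic [Finite V] (h : IsNear w M αs α Δ)
    (hC : IsGapStage w M (earning G w αs) F C s σ) (hΔ : 2 * Δ ≤ σ) (hη0 : 0 ≤ η)
    (hη : ∀ d, |bestOffer G w α d - α d| ≤ η) (hε0 : 0 ≤ ε)
    (hF : ∀ d : G.Dart, d.fst ∈ F → |α d - αs d| ≤ ε) :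
    IsStatic M C (edges w M (earning G w αs) C) (nodeDev M α αs) ε (2 * η) := by
  refine ⟨?_, ?_, ?_⟩
  · intro i hi k hk p hE hM hp
    have hadj := (hC.edge_value hE hM).1
    have h1 := h.nodeDev_ge hC hΔ hη ⟨(k, i), hadj.symm⟩ hi hM hE
    have h2 := abs_le.1 (h.unmatched_dev hC hΔ hη ⟨(k, i), hadj.symm⟩ hp
      (fun h' => hM (h' ▸ hp).symm) hk)
    change -(α _ - αs _) - η ≤ nodeDev M α αs i at h1
    change -η ≤ α _ - αs _ - (nodeDev M α αs k - nodeDev M α αs p) / 2 ∧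
      α _ - αs _ - (nodeDev M α αs k - nodeDev M α αs p) / 2 ≤ η at h2
    linarith
  · intro i hi
    obtain ⟨p, hp⟩ := hC.exists_partner i hi
    set d : G.Dart := ⟨(i, p), hp.adj_sub⟩ with hd
    have h5 : αs d = earning G w αs i - s := h.matched_message_eq hC d hp hi
    have h6 : nodeDev M α αs i = α d - αs d :=
      nodeDev_eq (α := α) (αs := αs) h.solution.isMatching d hp
    have h7 := abs_le.1 (hη d)
    by_cases hsmall : nodeDev M α αs i ≤ ε + 2 * η
    · exact Or.inl hsmall
    right
    push Not at hsmall
    have halt : 0 ≤ earning G w αs i - s := h5 ▸ h.nonneg_fixed d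
    obtain ⟨e, he, hep, hoff⟩ := exists_offer_eq_bestOffer (w := w) (α := α) (d := d)
      (by linarith)
    change e.snd = i at he
    change e.fst ≠ p at hep
    subst he
    have hM : ¬ M.Adj e.snd e.fst := fun h' => hep (hC.isMatching.eq_of_adj_left h' hp)
    have hval : offer G w α e ≤ w e.edge - α e := by
      have h8 := offer_le (w := w) (α := α) e
      have h9 : 0 < (w e.edge - α e)⁺ := by linarith
      rwa [posPart_eq_of_posPart_pos h9] at h8
    have hmsg := h.message_eq e fun h' => hM h'.symm
    have hbest := le_alternative (w := w) (γ := earning G w αs) e.adj.symm hep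
    have hbest' := le_posPart (w s(e.snd, e.fst) - earning G w αs e.fst)
    have hsl := hC.slack _ hi _ hp
    have hedge : w e.edge = w s(e.snd, e.fst) := by rw [dart_edge, Sym2.eq_swap]
    -- An offer from a settled node exceeds the second-best value by at most ε.
    have hFn : e.fst ∉ F := by
      intro hf
      have := abs_le.1 (hF e hf)
      linarith
    -- Elsewhere off the structure the offer is lower by the gap σ, which a perturbation Δ cannot
    -- make up.
    have hE : s(e.snd, e.fst) ∈ edges w M (earning G w αs) C := by
      by_contra hE
      have h8 := hC.gap _ hi _ e.adj.symm hM hE hFn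
      have h9 := abs_le.1 (h.near e)
      linarith [hC.gap_pos]
    have hk := (hC.mem_or_mem hE).resolve_right hFn
    obtain ⟨q, hq⟩ := hC.exists_partner _ hk
    have h8 := (hC.edge_value hE hM).2
    have h9 := abs_le.1 (h.unmatched_dev hC hΔ hη e hq (fun h' => hM (h' ▸ hq).symm) hk)
    exact ⟨e.fst, hk, q, hE, hM, hq, by linarith⟩
  · intro i hi hno
    obtain ⟨p, hp⟩ := hC.exists_partner i hi
    set d : G.Dart := ⟨(i, p), hp.adj_sub⟩ with hd
    have h6 : nodeDev M α αs i = α d - αs d :=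
      nodeDev_eq (α := α) (αs := αs) h.solution.isMatching d hp
    have h5 : αs d = alternative G w (earning G w αs) i p :=
      message_eq_alternative h.nonneg_fixed h.fixed h.solution d hp
    by_cases hpos : 0 < alternative G w (earning G w αs) i p
    · obtain ⟨k, hE, hM⟩ := hC.exists_edge hi hp hpos
      have hkF : k ∈ F := (hC.mem_or_mem hE).resolve_left fun hk => hM (hno k hk hE)
      have hadj := (hC.edge_value hE hM).1
      have h1 := h.nodeDev_ge hC hΔ hη ⟨(k, i), hadj.symm⟩ hi hM hE
      have h2 := abs_le.1 (hF ⟨(k, i), hadj.symm⟩ hkF)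
      change -(α _ - αs _) - η ≤ nodeDev M α αs i at h1
      linarith
    -- With no positive second-best offer the fixed message is 0, so the deviation is nonnegative.
    · have := h.nonneg d
      have := alternative_nonneg (G := G) (w := w) (earning G w αs) i p
      linarith

theorem IsNear.dev_le [Finite V] (h : IsNear w M αs α Δ)
    (hC : IsGapStage w M (earning G w αs) F C s σ) (hΔ : 2 * Δ ≤ σ) (hη0 : 0 ≤ η)
    (hη : ∀ d, |bestOffer G w α d - α d| ≤ η) {B : ℝ} (hB : ∀ i ∈ C, |nodeDev M α αs i| ≤ B)
    (d : G.Dart) (hd : d.fst ∈ C) : |α d - αs d| ≤ B + η := by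
  obtain ⟨p, hp⟩ := hC.exists_partner _ hd
  by_cases hpd : p = d.snd
  · subst hpd
    rw [← nodeDev_eq hC.isMatching d hp]
    linarith [hB _ hd]
  · have h1 := abs_le.1 (h.unmatched_dev hC hΔ hη d hp hpd hd)
    have h2 := abs_le.1 (hB _ hd)
    have h3 := abs_le.1 (hB _ (hC.closed _ _ hp hd))
    rw [abs_le]
    constructor <;> linarith

end Local

/-! ### The sup norm on message vectors -/

section Norm

variable {V : Type u} {G : SimpleGraph V} {w : Sym2 V → ℝ} [Fintype G.Dart]

theorem supDist_eq_norm (α β : G.Dart → ℝ) : supDist G α β = ‖α - β‖ := by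
  apply le_antisymm
  · exact Real.iSup_le (fun d => norm_le_pi_norm (α - β) d) (norm_nonneg _)
  · refine (pi_norm_le_iff_of_nonneg (Real.iSup_nonneg fun _ => abs_nonneg _)).2 fun d => ?_
    exact le_ciSup (f := fun d => |α d - β d|) (Set.finite_range _).bddAbove d

theorem norm_sub_le_iff {α β : G.Dart → ℝ} {c : ℝ} (hc : 0 ≤ c) :
    ‖α - β‖ ≤ c ↔ ∀ d, |α d - β d| ≤ c := by
  rw [pi_norm_le_iff_of_nonneg hc]; rfl

theorem bestOffer_nonexpansive [Finite V] (α β : G.Dart → ℝ) :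
    ‖bestOffer G w α - bestOffer G w β‖ ≤ ‖α - β‖ :=
  (norm_sub_le_iff (norm_nonneg _)).2
    (bestOffer_lipschitz (norm_nonneg _) ((norm_sub_le_iff (norm_nonneg _)).1 le_rfl))

end Norm

/-! ### Alternating cycles contradict uniqueness -/

section AlternatingCycle

variable {V : Type u} {G : SimpleGraph V} {w : Sym2 V → ℝ} {M : G.Subgraph}
  {αs : G.Dart → ℝ} {F C : Set V} {s σ : ℝ}

theorem IsAlternatingCycle.exists_sign {E : Set (Sym2 V)} (h : IsAlternatingCycle M E) :
    ∃ g : V → ℝ, (∀ v, g v = 1 ∨ g v = -1) ∧ ∀ i k, s(i, k) ∈ E → g k = -g i := by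
  classical
  obtain ⟨ℓ, p, hℓ, he, hp, hinj, -, rfl⟩ := h
  set g : V → ℝ := fun v => if ∃ i < ℓ, Even i ∧ v = p i then 1 else -1 with hg
  have hval : ∀ j < ℓ, g (p j) = if Even j then 1 else -1 := by
    intro j hj
    have : (∃ i < ℓ, Even i ∧ p j = p i) ↔ Even j := by
      constructor
      · rintro ⟨i, hi, hie, hpi⟩
        rwa [hinj (Set.mem_Iio.2 hj) (Set.mem_Iio.2 hi) hpi]
      · exact fun hje => ⟨j, hj, hje, rfl⟩
    simp only [hg, this]
  have hnext : ∀ j < ℓ, g (p (j + 1)) = -g (p j) := by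
    intro j hj
    rcases (show j + 1 ≤ ℓ from hj).eq_or_lt with h1 | h1
    · have hodd : ¬ Even j := by rw [← Nat.even_add_one, h1]; exact he
      rw [hval j hj, h1, hp, hval 0 (by omega), if_neg hodd]
      simp
    · rw [hval j hj, hval _ h1]
      by_cases hj : Even j <;> simp [Nat.even_add_one, hj]
  refine ⟨g, fun v => ?_, fun i k hik => ?_⟩
  · simp only [hg]
    split_ifs <;> simp
  · obtain ⟨j, hj, ⟨rfl, rfl⟩ | ⟨rfl, rfl⟩⟩ := mem_seqEdges hik
    · exact hnext j hj
    · rw [hnext j hj, neg_neg]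

theorem IsAlternatingCycle.mem_of_edge {E : Set (Sym2 V)} (h : IsAlternatingCycle M E)
    (hF : IsFrame M C E) {i k : V} (hik : s(i, k) ∈ E) : k ∈ C := by
  obtain ⟨ℓ, p, hℓ, he, hp, -, halt, rfl⟩ := h
  have hlt : ∀ j < ℓ, p j ∈ C := by
    intro j hj
    rcases Nat.even_or_odd j with hj' | ⟨a, rfl⟩
    · exact hF.mem_of_edge _ _ ⟨j, hj, rfl⟩ ((halt j hj).2 hj')
    · have hadj := (halt (2 * a) (by omega)).2 (even_two_mul a)
      exact hF.closed _ _ hadj (hF.mem_of_edge _ _ ⟨2 * a, by omega, rfl⟩ hadj)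
  have hle : ∀ j ≤ ℓ, p j ∈ C := by
    intro j hj
    rcases hj.eq_or_lt with rfl | hj
    · rw [hp]; exact hlt 0 (by omega)
    · exact hlt j hj
  obtain ⟨j, hj, ⟨-, rfl⟩ | ⟨-, rfl⟩⟩ := mem_seqEdges hik
  · exact hle _ hj
  · exact hle _ hj.le

/-- The message vectors near `αs` which are shifted by `ε g` on `C`. -/
def shiftedSet (αs : G.Dart → ℝ) (C : Set V) (g : V → ℝ) (ε : ℝ) : Set (G.Dart → ℝ) :=
  {α | ∀ d, 0 ≤ α d ∧ |α d - αs d| ≤ ε ∧ (d.fst ∈ C → α d = αs d + ε * g d.fst)}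

theorem isCompact_shiftedSet (αs : G.Dart → ℝ) (C : Set V) (g : V → ℝ) (ε : ℝ) :
    IsCompact (shiftedSet αs C g ε) := by
  have : shiftedSet αs C g ε = Set.pi Set.univ fun d : G.Dart =>
      {y | 0 ≤ y ∧ |y - αs d| ≤ ε ∧ (d.fst ∈ C → y = αs d + ε * g d.fst)} := by
    ext α; simp [shiftedSet]
  rw [this]
  refine isCompact_univ_pi fun d => ?_
  refine (isCompact_Icc (a := αs d - ε) (b := αs d + ε)).of_isClosed_subset ?_ ?_
  · refine (isClosed_le continuous_const continuous_id).inter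
      ((isClosed_le (continuous_id.sub continuous_const).abs continuous_const).inter ?_)
    change IsClosed {y | d.fst ∈ C → y = αs d + ε * g d.fst}
    by_cases hd : d.fst ∈ C
    · simp [hd]
    · simp [hd]
  · rintro y ⟨-, hy, -⟩
    have := abs_le.1 hy
    exact ⟨by linarith, by linarith⟩

/-- All second-best offers in `C` are positive here, so an unmatched edge off the structure is
strictly worse than second best; finitely many strict inequalities leave room for ε. -/
theorem IsGapStage.exists_shift [Finite V] (hC : IsGapStage w M (earning G w αs) F C s σ)
    (hpos : ∀ i ∈ C, s < earning G w αs i) :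
    ∃ ε > 0, 2 * ε ≤ σ ∧ (∀ i ∈ C, ε ≤ earning G w αs i - s) ∧
      ∀ i ∈ C, ∀ k, G.Adj i k → ¬ M.Adj i k → s(i, k) ∉ edges w M (earning G w αs) C →
        w s(i, k) - earning G w αs k + 2 * ε ≤ earning G w αs i - s := by
  have ev : ∀ c : ℝ, 0 < c → ∀ᶠ ε in nhdsWithin (0 : ℝ) (Set.Ioi 0), 2 * ε ≤ c := by
    intro c hc
    filter_upwards [Ioc_mem_nhdsGT (half_pos hc)] with ε hε
    linarith [hε.2]
  have e1 : ∀ᶠ ε in nhdsWithin (0 : ℝ) (Set.Ioi 0), ∀ i, i ∈ C →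
      ε ≤ earning G w αs i - s := by
    rw [Filter.eventually_all]
    intro i
    by_cases hi : i ∈ C
    · filter_upwards [ev _ (sub_pos.2 (hpos i hi)), self_mem_nhdsWithin] with ε h1 h2 _
      have : (0 : ℝ) < ε := h2
      linarith
    · exact Filter.Eventually.of_forall fun _ h => absurd h hi
  have e2 : ∀ᶠ ε in nhdsWithin (0 : ℝ) (Set.Ioi 0), ∀ i k, i ∈ C → G.Adj i k → ¬ M.Adj i k →
      s(i, k) ∉ edges w M (earning G w αs) C →
        w s(i, k) - earning G w αs k + 2 * ε ≤ earning G w αs i - s := by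
    rw [Filter.eventually_all]
    intro i
    rw [Filter.eventually_all]
    intro k
    by_cases hi : i ∈ C ∧ G.Adj i k ∧ ¬ M.Adj i k ∧ s(i, k) ∉ edges w M (earning G w αs) C
    · obtain ⟨hi, hadj, hM, hE⟩ := hi
      obtain ⟨p, hp⟩ := hC.exists_partner i hi
      have hkp : k ≠ p := fun h => hM (h ▸ hp)
      have h1 := le_alternative (w := w) (γ := earning G w αs) hadj hkp
      have h2 := hC.slack i hi p hp
      have h3 := le_posPart (w s(i, k) - earning G w αs k)
      have h4 := hpos i hi
      have hlt : w s(i, k) - earning G w αs k < earning G w αs i - s := by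
        refine lt_of_le_of_ne (by linarith) fun heq => hE (Or.inr ?_)
        exact ⟨i, hi, p, k, hp, hadj, hkp, by linarith, by linarith, rfl⟩
      filter_upwards [ev _ (sub_pos.2 hlt)] with ε h1 _ _ _ _
      linarith
    · exact Filter.Eventually.of_forall fun _ h1 h2 h3 h4 => absurd ⟨h1, h2, h3, h4⟩ hi
  obtain ⟨ε, h1, h2, h3, h4⟩ :=
    ((ev σ hC.gap_pos).and (e1.and (e2.and self_mem_nhdsWithin))).exists
  exact ⟨ε, h4, h1, h2, fun i hi k => h3 i k hi⟩

/-- Since g changes sign along every structure edge, a cycle neighbour shifted by -ε g i raises its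
offer to i by ε g i, and the partner's offer rises by (ε g i + ε g i) / 2. So the shift reproduces
itself, whatever the other messages near `αs` are. -/
theorem IsNear.bestOffer_shifted [Finite V] {α : G.Dart → ℝ} {g : V → ℝ} {ε : ℝ}
    (h : IsNear w M αs α ε) (hC : IsGapStage w M (earning G w αs) F C s σ)
    (hcyc : IsAlternatingCycle M (edges w M (earning G w αs) C))
    (hg : ∀ v, g v = 1 ∨ g v = -1)
    (hedge : ∀ i k, s(i, k) ∈ edges w M (earning G w αs) C → g k = -g i)
    (hε : 0 < ε) (hεσ : 2 * ε ≤ σ) (hεs : ∀ i ∈ C, ε ≤ earning G w αs i - s)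
    (hεw : ∀ i ∈ C, ∀ k, G.Adj i k → ¬ M.Adj i k → s(i, k) ∉ edges w M (earning G w αs) C →
        w s(i, k) - earning G w αs k + 2 * ε ≤ earning G w αs i - s)
    (hα : ∀ d, d.fst ∈ C → α d = αs d + ε * g d.fst) (d : G.Dart) (hd : d.fst ∈ C) :
    bestOffer G w α d = αs d + ε * g d.fst := by
  have hF := hC.isFrame
  obtain ⟨p, hp⟩ := hC.exists_partner _ hd
  have hgε : ∀ v, -ε ≤ ε * g v := by
    intro v
    rcases hg v with h1 | h1 <;> rw [h1] <;> linarith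
  by_cases hpd : p = d.snd
  · subst hpd
    rw [h.matched_message_eq hC d hp hd]
    have hge := hgε d.fst
    have hes := hεs _ hd
    have hEq : ∀ e : G.Dart, e.snd = d.fst → ¬ M.Adj e.snd e.fst →
        s(e.snd, e.fst) ∈ edges w M (earning G w αs) C →
        offer G w α e = earning G w αs d.fst - s + ε * g d.fst := by
      intro e he hM hE
      have hk := hcyc.mem_of_edge hF hE
      rw [h.edge_offer hC hεσ e hM hE, hα e hk, hedge _ _ hE, he,
        posPart_eq_self.2 (by linarith)]
      ring
    apply le_antisymm
    · refine bestOffer_le (by linarith) fun e he he' => ?_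
      have hM : ¬ M.Adj e.snd e.fst := fun h' =>
        he' (hC.isMatching.eq_of_adj_left (he ▸ h') hp)
      by_cases hE : s(e.snd, e.fst) ∈ edges w M (earning G w αs) C
      · exact (hEq e he hM hE).le
      · have h1 := hεw _ (he ▸ hd) _ e.adj.symm hM hE
        have h2 := h.message_eq e fun h' => hM h'.symm
        have h3 := abs_le.1 (h.near e)
        rw [Sym2.eq_swap, ← dart_edge, he] at h1
        refine (offer_le e).trans ?_
        rw [posPart_def]
        exact max_le (by linarith) (by linarith)
    · have halt := hC.slack _ hd _ hp
      obtain ⟨k, hE, hM⟩ := hC.exists_edge hd hp (by linarith)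
      have hadj := (hC.edge_value hE hM).1
      rw [← hEq ⟨(k, d.fst), hadj.symm⟩ rfl hM hE]
      exact offer_le_bestOffer rfl fun h' => hM ((show k = d.snd from h') ▸ hp)
  · have hx : ∀ i p, M.Adj i p → i ∈ C → nodeDev M α αs i = ε * g i := by
      intro i p hp hi
      have h1 := nodeDev_eq (α := α) (αs := αs) hC.isMatching ⟨(i, p), hp.adj_sub⟩ hp
      rw [hα ⟨(i, p), hp.adj_sub⟩ hi] at h1
      change nodeDev M α αs i = _ at h1
      rw [h1]
      ring
    rw [h.bestOffer_eq hC hεσ d hp hpd hd, hx _ _ hp hd, hx _ _ hp.symm (hC.closed _ _ hp hd),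
      hedge _ _ (hF.edge_mem _ _ hp hd),
      h.message_eq d fun h' => hpd (hC.isMatching.eq_of_adj_left hp h')]
    ring

/-- An alternating cycle all of whose nodes have larger earnings than its slack gives rise to
further fixed points of the dynamics. -/
theorem IsGapStage.not_isAlternatingCycle [Finite V]
    (hC : IsGapStage w M (earning G w αs) F C s σ) (h0 : ∀ d, 0 ≤ αs d)
    (hfix : bestOffer G w αs = αs) (hN : IsNBSolution w M (earning G w αs))
    (huniq : ∀ β : G.Dart → ℝ, (∀ d, 0 ≤ β d) → bestOffer G w β = β → β = αs)
    (hpos : ∀ i ∈ C, s < earning G w αs i) :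
    ¬ IsAlternatingCycle M (edges w M (earning G w αs) C) := by
  intro hcyc
  have : Fintype G.Dart := Fintype.ofFinite _
  classical
  obtain ⟨g, hg, hedge⟩ := hcyc.exists_sign
  obtain ⟨ε, hε, hεσ, hεs, hεw⟩ := hC.exists_shift hpos
  have hgabs : ∀ v, |ε * g v| ≤ ε := by
    intro v
    rcases hg v with h1 | h1 <;> rw [h1] <;> simp [abs_of_pos hε]
  set K := shiftedSet αs C g ε with hK
  have hnear : ∀ α ∈ K, IsNear w M αs α ε := fun α hα =>
    ⟨h0, hfix, hN, fun d => (hα d).1, fun d => (hα d).2.1⟩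
  have hbest : ∀ α ∈ K, ∀ d, d.fst ∈ C → bestOffer G w α d = αs d + ε * g d.fst :=
    fun α hα => (hnear α hα).bestOffer_shifted hC hcyc hg hedge hε hεσ hεs hεw
      fun d => (hα d).2.2
  set α₀ : G.Dart → ℝ := fun d => αs d + if d.fst ∈ C then ε * g d.fst else 0 with hα₀
  have hα₀K : α₀ ∈ K := by
    intro d
    by_cases hd : d.fst ∈ C
    · simp only [hα₀, if_pos hd, add_sub_cancel_left]
      refine ⟨?_, hgabs _, fun _ => trivial⟩
      obtain ⟨p, hp⟩ := hC.exists_partner _ hd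
      have h1 := hεs _ hd
      have h2 := (abs_le.1 (hgabs d.fst)).1
      have h3 : earning G w αs d.fst - s ≤ αs d := by
        by_cases hM : M.Adj d.fst d.snd
        · linarith [hC.slack _ hd _ hM, message_eq_alternative h0 hfix hN d hM]
        · linarith [message_eq_earning h0 hfix hN d hM, hC.gap_pos, hC.gap_le]
      linarith
    · simp only [hα₀, if_neg hd]
      exact ⟨by simpa using h0 d, by simpa using hε.le, fun h => absurd h hd⟩
  have hinv : ∀ α ∈ K, averaged (1 / 2) (bestOffer G w) α ∈ K := by
    intro α hα d
    have hn := hnear α hα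
    have h1 := abs_le.1 (bestOffer_lipschitz (w := w) hε.le hn.near d)
    have h2 := abs_le.1 (hn.near d)
    have h3 := bestOffer_nonneg (w := w) hn.nonneg d
    have h4 := hn.nonneg d
    rw [hfix] at h1
    simp only [averaged, Pi.add_apply, Pi.smul_apply, smul_eq_mul]
    refine ⟨by linarith, abs_le.2 ⟨by linarith, by linarith⟩, fun hd => ?_⟩
    rw [hbest α hα d hd, (hα d).2.2 hd]
    ring
  have hiter : ∀ t, (averaged (1 / 2) (bestOffer G w))^[t] α₀ ∈ K := by
    intro t
    induction t with
    | zero => exact hα₀K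
    | succ t ih => rw [Function.iterate_succ_apply']; exact hinv _ ih
  have hcont : Continuous (bestOffer G w) :=
    (LipschitzWith.mk_one fun α β => by
      rw [dist_eq_norm, dist_eq_norm]; exact bestOffer_nonexpansive α β).continuous
  -- Messages of nodes outside `C` are free in K, so a fixed point must still be found there. K is
  -- compact and invariant under the half-averaged map, whose residuals tend to 0; hence the least
  -- residual on K is 0.
  obtain ⟨y, hyK, hy⟩ := (isCompact_shiftedSet αs C g ε).exists_isMinOn ⟨α₀, hα₀K⟩
    (f := fun α => ‖bestOffer G w α - α‖) (by fun_prop)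
  have hα₀n : ‖α₀ - αs‖ ≤ ε := (norm_sub_le_iff hε.le).2 fun d => (hα₀K d).2.1
  have hsmall : ‖bestOffer G w y - y‖ = 0 := by
    by_contra hne
    have hpos' : 0 < ‖bestOffer G w y - y‖ := lt_of_le_of_ne (norm_nonneg _) (Ne.symm hne)
    set c := ‖bestOffer G w y - y‖ with hc
    -- Chosen so that c H > 16 ε, against the bound 8 ε / (κ H) = 16 ε / H on the residual.
    set H : ℝ := 2 + 16 * ε / c + 1 with hH
    have hq : 0 ≤ 16 * ε / c := by positivity
    have h1 := asymptotic_regularity (κ := 1 / 2) (H := H) (by norm_num) (by norm_num)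
      (bestOffer_nonexpansive (w := w)) hfix hα₀n (by linarith) (by norm_num; linarith)
      (t := ⌈H ^ 2⌉₊) (by linarith [Nat.le_ceil (H ^ 2)])
    have h2 := (isMinOn_iff.1 hy) _ (hiter ⌈H ^ 2⌉₊)
    simp only [← hc] at h2
    have h3 : c ≤ 16 * ε / H := by
      refine (h2.trans h1).trans (le_of_eq ?_)
      field_simp
      norm_num
    rw [le_div_iff₀ (by linarith), hH] at h3
    have h4 : c * (16 * ε / c) = 16 * ε := by field_simp
    nlinarith
  have hyfix : bestOffer G w y = y := sub_eq_zero.1 (norm_eq_zero.1 hsmall)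
  have hyαs := huniq y (fun d => (hyK d).1) hyfix
  obtain ⟨i, hi⟩ := hC.nonempty
  obtain ⟨p, hp⟩ := hC.exists_partner i hi
  have h1 := (hyK ⟨(i, p), hp.adj_sub⟩).2.2 hi
  rw [hyαs] at h1
  change αs ⟨(i, p), hp.adj_sub⟩ = αs ⟨(i, p), hp.adj_sub⟩ + ε * g i at h1
  rcases hg i with h2 | h2 <;> rw [h2] at h1 <;> linarith

end AlternatingCycle

/-! ### The error bound, stage by stage -/

section Contraction

variable {V : Type u} {G : SimpleGraph V} {w : Sym2 V → ℝ} {M : G.Subgraph}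
  {αs α : G.Dart → ℝ} {F C : Set V} {s σ Δ η ε : ℝ}

/-- The static relations hold with precision 2 η, which gives 26 n² η on messages to partners; the
other messages cost one more η. -/
theorem IsNear.stage_dev_le [Fintype V] (h : IsNear w M αs α Δ)
    (hC : IsGapStage w M (earning G w αs) F C s σ) (hΔ : 2 * Δ ≤ σ)
    (huniq : ∀ β : G.Dart → ℝ, (∀ d, 0 ≤ β d) → bestOffer G w β = β → β = αs) (hη0 : 0 ≤ η)
    (hη : ∀ d, |bestOffer G w α d - α d| ≤ η) (hε0 : 0 ≤ ε)
    (hF : ∀ d : G.Dart, d.fst ∈ F → |α d - αs d| ≤ ε) (d : G.Dart) (hd : d.fst ∈ C) :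
    |α d - αs d| ≤ ε + 27 * (Fintype.card V : ℝ) ^ 2 * η := by
  have hS := h.isStatic hC hΔ hη0 hη hε0 hF
  have hs : 0 ≤ 2 * η := by linarith
  have hn : (1 : ℝ) ≤ Fintype.card V := by
    exact_mod_cast Fintype.card_pos_iff.2 ⟨d.fst⟩
  have hn2 : η ≤ (Fintype.card V : ℝ) ^ 2 * η := le_mul_of_one_le_left hη0 (by nlinarith)
  have hB : ∀ i ∈ C, |nodeDev M α αs i| ≤ ε + 13 * (Fintype.card V : ℝ) ^ 2 * (2 * η) := by
    rcases hC.topology with hT | hT | hT | ⟨hT, hpos⟩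
    · intro i hi
      refine (hT.bound hC.isFrame hS hs hC.nonempty i hi).trans ?_
      gcongr
      norm_num
    · exact hT.bound hC.isFrame hS hs hε0
    · exact hT.bound hC.isFrame hS hs hε0
    · exact absurd hT (hC.not_isAlternatingCycle h.nonneg_fixed h.fixed h.solution huniq hpos)
  refine (h.dev_le hC hΔ hη0 hη hB d hd).trans ?_
  linarith

/-- A neighbour k of an unmatched node is matched, as the weights are positive, and γ k exceeds the
weight by at least s ≥ Δ. So all offers to the unmatched node vanish, also after perturbation. -/
theorem IsNear.unmatched_node_dev [Finite V] (h : IsNear w M αs α Δ)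
    (hw : ∀ e ∈ G.edgeSet, 0 < w e) (hΔ : 2 * Δ ≤ σ)
    (hη : ∀ d, |bestOffer G w α d - α d| ≤ η)
    (hcover : ∀ i ∈ M.verts, ∃ F C s, IsGapStage w M (earning G w αs) F C s σ ∧ i ∈ C)
    (d : G.Dart) (hd : d.fst ∉ M.verts) : |α d - αs d| ≤ η := by
  have h0 : αs d = 0 := by
    rw [h.message_eq d fun hM => hd (M.edge_vert hM)]
    exact h.solution.unmatched _ hd
  have hΔ0 : 0 ≤ Δ := (abs_nonneg _).trans (h.near d)
  have hb : bestOffer G w α d = 0 := by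
    refine le_antisymm (bestOffer_le le_rfl fun e he _ => ?_) (bestOffer_nonneg h.nonneg d)
    have hi : e.snd ∉ M.verts := he ▸ hd
    have hne : ¬ M.Adj e.fst e.snd := fun hM => hi (M.edge_vert hM.symm)
    have hγ := h.solution.unmatched _ hi
    have hmsg := h.message_eq e hne
    have hnear := abs_le.1 (h.near e)
    have hk : e.fst ∈ M.verts := by
      by_contra hk
      have h1 := h.solution.stable _ _ e.adj hne
      have h2 := hw s(e.fst, e.snd) e.adj
      linarith [h.solution.unmatched _ hk]
    obtain ⟨F, C, s, hC, hkC⟩ := hcover _ hk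
    have h1 := hC.edge_slack _ hkC _ e.adj hne
    rw [← dart_edge] at h1
    refine (offer_le e).trans (posPart_eq_zero.2 ?_).le
    linarith [hC.gap_le]
  have := hη d
  rwa [hb, ← h0, abs_sub_comm] at this

/-- Near the fixed point, an approximate fixed point of precision `η` is at distance
`O (n ^ 3 η)`. -/
theorem IsNear.dev_le_of_approx [Fintype V] (h : IsNear w M αs α Δ)
    (hw : ∀ e ∈ G.edgeSet, 0 < w e) (hσ : 0 < σ) (hgap : HasGap w M (earning G w αs) σ)
    (hΔ : 2 * Δ ≤ σ)
    (huniq : ∀ β : G.Dart → ℝ, (∀ d, 0 ≤ β d) → bestOffer G w β = β → β = αs) (hη0 : 0 ≤ η)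
    (hη : ∀ d, |bestOffer G w α d - α d| ≤ η) (d : G.Dart) :
    |α d - αs d| ≤ 28 * (Fintype.card V : ℝ) ^ 3 * η := by
  obtain ⟨k, C, s, hKT, h0, h1, h2⟩ := hgap
  have hst := hKT.isGapStage h.solution hσ h0 h1 h2
  have hcover : ∀ i ∈ M.verts, ∃ F C s, IsGapStage w M (earning G w αs) F C s σ ∧ i ∈ C := by
    intro i hi
    have : i ∈ settledBefore M C k := hKT.2 ▸ Set.mem_univ i
    obtain ⟨q, hq, hiq⟩ := (mem_settledBefore.1 this).resolve_left (not_not.2 hi)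
    exact ⟨_, _, _, hst q hq, hiq⟩
  have hind : ∀ q ≤ k, ∀ d : G.Dart, d.fst ∈ settledBefore M C q →
      |α d - αs d| ≤ η + q * (27 * (Fintype.card V : ℝ) ^ 2 * η) := by
    intro q
    induction q with
    | zero =>
      intro _ d hd
      rcases mem_settledBefore.1 hd with hd | ⟨p, hp, -⟩
      · simpa using h.unmatched_node_dev hw hΔ hη hcover d hd
      · omega
    | succ q ih =>
      intro hq d hd
      have ih' := ih (by omega)
      push_cast
      have hpos : 0 ≤ 27 * (Fintype.card V : ℝ) ^ 2 * η := by positivity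
      have hpos' : 0 ≤ q * (27 * (Fintype.card V : ℝ) ^ 2 * η) := by positivity
      by_cases hdq : d.fst ∈ settledBefore M C q
      · linarith [ih' d hdq]
      · have hdC : d.fst ∈ C q := by
          rw [mem_settledBefore] at hd hdq
          push Not at hdq
          rcases hd with hd | ⟨p, hp, hdp⟩
          · exact absurd hdq.1 hd
          · obtain rfl : p = q := by
              by_contra hne
              exact hdq.2 p (by omega) hdp
            exact hdp
        have := h.stage_dev_le (hst q (by omega)) hΔ huniq hη0 hη (by linarith) ih' d hdC
        linarith
  -- The structures are nonempty and disjoint, so a choice of one node in each is injective.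
  have hk : k ≤ Fintype.card V := by
    have hne : ∀ q : ℕ, ∃ i : V, q < k → i ∈ C q := by
      intro q
      by_cases hq : q < k
      · obtain ⟨i, hi⟩ := (hst q hq).nonempty
        exact ⟨i, fun _ => hi⟩
      · exact ⟨d.fst, fun h => absurd h hq⟩
    choose f hf using hne
    have hlt : ∀ p q, p < q → q < k → f p ≠ f q := by
      intro p q hpq hq he
      refine Set.disjoint_left.1 (hst q hq).unsettled (hf q hq) (mem_settledBefore.2 ?_)
      exact Or.inr ⟨p, hpq, he ▸ hf p (by omega)⟩
    refine le_card_of_injective_below (f := f) fun p hp q hq he => ?_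
    rcases lt_trichotomy p q with h' | h' | h'
    · exact absurd he (hlt p q h' hq)
    · exact h'
    · exact absurd he.symm (hlt q p h' hp)
  have hfin := hind k le_rfl d (hKT.2 ▸ Set.mem_univ _)
  have hn : (1 : ℝ) ≤ Fintype.card V := by
    exact_mod_cast Fintype.card_pos_iff.2 ⟨d.fst⟩
  have hkn : (k : ℝ) ≤ Fintype.card V := by exact_mod_cast hk
  have e1 : (k : ℝ) * (27 * (Fintype.card V : ℝ) ^ 2 * η) ≤
      Fintype.card V * (27 * (Fintype.card V : ℝ) ^ 2 * η) := by gcongr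
  have e2 : η ≤ (Fintype.card V : ℝ) ^ 3 * η := le_mul_of_one_le_left hη0 (one_le_pow₀ hn)
  linarith

theorem averaged_iterate_nonneg {κ : ℝ} (h0 : 0 ≤ κ) (h1 : κ ≤ 1) (t : ℕ) {α : G.Dart → ℝ}
    (hα : ∀ d, 0 ≤ α d) : ∀ d, 0 ≤ (averaged κ (bestOffer G w))^[t] α d := by
  induction t with
  | zero => exact hα
  | succ t ih =>
    intro d
    rw [Function.iterate_succ_apply']
    simp only [averaged, Pi.add_apply, Pi.smul_apply, smul_eq_mul]
    have := bestOffer_nonneg (w := w) ih d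
    have := ih d
    have : 0 ≤ 1 - κ := by linarith
    positivity

end Contraction

/-! ### Halving the distance -/

section Halving

variable {V : Type u} [Fintype V] {G : SimpleGraph V} [Fintype G.Dart] {w : Sym2 V → ℝ}
  {M : G.Subgraph} {αs : G.Dart → ℝ} {σ κ : ℝ}

/-- Within distance `σ / 2` of the fixed point, the distance is halved in time `O (n ^ 6)`. -/
theorem halving (h0 : 0 < κ) (h1 : κ < 1) (hn : 0 < Fintype.card V)
    (hw : ∀ e ∈ G.edgeSet, 0 < w e) (hα0 : ∀ d, 0 ≤ αs d) (hfix : bestOffer G w αs = αs)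
    (huniq : ∀ β : G.Dart → ℝ, (∀ d, 0 ≤ β d) → bestOffer G w β = β → β = αs)
    (hN : IsNBSolution w M (earning G w αs)) (hσ : 0 < σ)
    (hgap : HasGap w M (earning G w αs) σ) {t : ℕ}
    (ht : 448 ^ 2 / (κ * (1 - κ)) * (Fintype.card V : ℝ) ^ 6 ≤ t) {Δ : ℝ} (hΔ : 2 * Δ ≤ σ)
    {α : G.Dart → ℝ} (hα : ∀ d, 0 ≤ α d) (hd : ‖α - αs‖ ≤ Δ) :
    ‖(averaged κ (bestOffer G w))^[t] α - αs‖ ≤ Δ / 2 := by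
  set n : ℝ := (Fintype.card V : ℝ) with hn'
  have hn1 : 1 ≤ n := by rw [hn']; exact_mod_cast hn
  have hn3 : 1 ≤ n ^ 3 := one_le_pow₀ hn1
  have hΔ0 : 0 ≤ Δ := (norm_nonneg _).trans hd
  -- With this H the residual is at most 8 Δ / (κ H) = Δ / (56 n³), and the error bound multiplies
  -- it by 28 n³.
  set H : ℝ := 448 * n ^ 3 / κ with hH
  have hHκ : 1 / κ ≤ H := by
    rw [hH]; gcongr; linarith
  have hκ1 : 1 ≤ 1 / κ := (one_le_div h0).2 h1.le
  have htime : H ^ 2 * κ ≤ (1 - κ) * t := by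
    have h3 := mul_le_mul_of_nonneg_left ht (by linarith : 0 ≤ 1 - κ)
    refine le_trans (le_of_eq ?_) h3
    have : 1 - κ ≠ 0 := by linarith
    rw [hH]
    field_simp
  have hreg := asymptotic_regularity h0 h1 (bestOffer_nonexpansive (w := w)) hfix hd
    (hκ1.trans hHκ) hHκ htime
  have hη : 8 * Δ / (κ * H) = Δ / (56 * n ^ 3) := by
    rw [hH]; field_simp; ring
  rw [hη] at hreg
  have hη0 : 0 ≤ Δ / (56 * n ^ 3) := by positivity
  set β := (averaged κ (bestOffer G w))^[t] α with hβ
  have hβd : ‖β - αs‖ ≤ Δ := by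
    have h3 := iterate_nonexpansive
      (averaged_nonexpansive h0.le h1.le (bestOffer_nonexpansive (w := w))) t α αs
    rw [Function.iterate_fixed (averaged_fixed hfix) t] at h3
    exact h3.trans hd
  have hnear : IsNear w M αs β Δ :=
    ⟨hα0, hfix, hN, averaged_iterate_nonneg h0.le h1.le t hα, (norm_sub_le_iff hΔ0).1 hβd⟩
  refine (norm_sub_le_iff (by linarith)).2 fun d => ?_
  refine (hnear.dev_le_of_approx hw hσ hgap hΔ huniq hη0
    ((norm_sub_le_iff hη0).1 hreg) d).trans (le_of_eq ?_)
  rw [← hn']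
  field_simp
  ring

end Halving

end ExchangeNetwork

/-! ### From halving near the fixed point to all distances -/

theorem theorem4 (κ : ℝ) (hκ₀ : 0 < κ) (hκ₁ : κ < 1) :
    ∃ K : ℝ, ∀ (V : Type u) [Fintype V] (G : SimpleGraph V) (w : Sym2 V → ℝ),
      (∀ e ∈ G.edgeSet, 0 < w e) →
      ∀ (M : G.Subgraph) (αs : G.Dart → ℝ) (σ : ℝ),
        (∀ d, 0 ≤ αs d) →
        step G w κ αs = αs →
        (∀ β : G.Dart → ℝ, (∀ d, 0 ≤ β d) → step G w κ β = β → β = αs) →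
        IsNBSolution w M (earning G w αs) →
        HasGap w M (earning G w αs) σ →
        ∀ (Δ : ℝ) (α₀ : G.Dart → ℝ), (∀ d, 0 ≤ α₀ d) →
          supDist G α₀ αs ≤ Δ →
          ∀ t : ℕ, K * (Fintype.card V : ℝ) ^ 7 ≤ (t : ℝ) →
            supDist G ((step G w κ)^[t] α₀) αs ≤ Δ - min σ Δ / 2 := by
  set K₀ : ℝ := 448 ^ 2 / (κ * (1 - κ)) with hK₀
  have hκ' : 0 < 1 - κ := by linarith
  have hK₀pos : 0 ≤ K₀ := by positivity
  refine ⟨3 * (K₀ + 1), ?_⟩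
  intro V _ G w hw M αs σ hαs hfix huniq hN hgap Δ α₀ hα₀ hd t ht
  have : Fintype G.Dart := Fintype.ofFinite _
  simp only [step_fixed_iff hκ₀.ne'] at hfix huniq
  rw [supDist_eq_norm] at hd ⊢
  rw [step_eq_averaged]
  have hΔ0 : 0 ≤ Δ := (norm_nonneg _).trans hd
  set T := averaged κ (bestOffer G w) with hT
  have hTne : ∀ x y, ‖T x - T y‖ ≤ ‖x - y‖ :=
    averaged_nonexpansive hκ₀.le hκ₁.le (bestOffer_nonexpansive (w := w))
  have hTfix : ∀ t, T^[t] αs = αs := fun t => Function.iterate_fixed (averaged_fixed hfix) t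
  have hmono : ∀ (t : ℕ) (α : G.Dart → ℝ) (r : ℝ), ‖α - αs‖ ≤ r → ‖T^[t] α - αs‖ ≤ r := by
    intro t α r h
    have := iterate_nonexpansive hTne t α αs
    rw [hTfix] at this
    exact this.trans h
  rcases le_or_gt σ 0 with hσ | hσ
  · refine (hmono t α₀ Δ hd).trans ?_
    linarith [min_le_left σ Δ]
  rcases Nat.eq_zero_or_pos (Fintype.card V) with hn | hn
  · have : IsEmpty V := Fintype.card_eq_zero_iff.1 hn
    have : IsEmpty G.Dart := ⟨fun d => this.elim d.fst⟩
    rw [Subsingleton.elim (T^[t] α₀ - αs) 0, norm_zero]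
    linarith [min_le_right σ Δ]
  have hn1 : (1 : ℝ) ≤ Fintype.card V := by exact_mod_cast hn
  set A : Set (G.Dart → ℝ) := Set.Ici 0 with hA
  have hAmem : ∀ {α : G.Dart → ℝ}, α ∈ A ↔ ∀ d, 0 ≤ α d := by
    intro α; simp [hA, Pi.le_def]
  have hAconv : Convex ℝ A := convex_Ici 0
  set T₀ : ℕ := ⌈K₀ * (Fintype.card V : ℝ) ^ 6⌉₊ with hT₀
  have hhalf : ∀ t, T₀ ≤ t → ∀ r, 2 * r ≤ σ → ∀ α ∈ A, ‖α - αs‖ ≤ r → ‖T^[t] α - αs‖ ≤ r / 2 := by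
    intro t ht r hr α hα hαr
    refine halving hκ₀ hκ₁ hn hw hαs hfix huniq hN hσ hgap ?_ hr (hAmem.1 hα) hαr
    exact Nat.ceil_le.1 ht
  -- For σ/2 ≤ r ≤ σ, the progress σ/4 available from distance σ/2 carries over, and r - σ/4 ≤ 3 r /
  -- 4.
  have hstep : ∀ t, T₀ ≤ t → ∀ r, r ≤ σ → ∀ α ∈ A, ‖α - αs‖ ≤ r →
      ‖T^[t] α - αs‖ ≤ 3 / 4 * r := by
    intro t ht r hr α hα hαr
    have hr0 : 0 ≤ r := (norm_nonneg _).trans hαr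
    rcases le_total (2 * r) σ with h | h
    · linarith [hhalf t ht r h α hα hαr]
    · have := progress_of_le hTne hAconv (hAmem.2 hαs) (r := σ / 2) (by linarith)
        (hhalf t ht (σ / 2) (by linarith)) (Δ := r) (by linarith) hα hαr
      linarith
  -- Three rounds suffice because (3/4)³ = 27/64 < 1/2.
  have hthree : ∀ t, 3 * T₀ ≤ t → ∀ r, r ≤ σ → ∀ α ∈ A, ‖α - αs‖ ≤ r →
      ‖T^[t] α - αs‖ ≤ r / 2 := by
    intro t ht r hr α hα hαr
    have hr0 : 0 ≤ r := (norm_nonneg _).trans hαr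
    obtain ⟨u, rfl⟩ : ∃ u, t = u + T₀ + T₀ := ⟨t - T₀ - T₀, by omega⟩
    have hpos : ∀ β ∈ A, T^[T₀] β ∈ A := fun β hβ =>
      hAmem.2 (averaged_iterate_nonneg hκ₀.le hκ₁.le T₀ (hAmem.1 hβ))
    rw [Function.iterate_add_apply, Function.iterate_add_apply]
    have h1 := hstep T₀ le_rfl r hr α hα hαr
    have h2 := hstep T₀ le_rfl _ (by linarith) _ (hpos _ hα) h1
    have h3 := hstep u (by omega) _ (by linarith) _ (hpos _ (hpos _ hα)) h2
    linarith
  -- Three rounds need time of order n⁶ only; the 1 in the constant absorbs the rounding up in T₀.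
  have ht3 : 3 * T₀ ≤ t := by
    have h1 : (T₀ : ℝ) < K₀ * (Fintype.card V : ℝ) ^ 6 + 1 := Nat.ceil_lt_add_one (by positivity)
    have h2 : (Fintype.card V : ℝ) ^ 6 ≤ (Fintype.card V : ℝ) ^ 7 :=
      pow_le_pow_right₀ hn1 (by norm_num)
    have h3 : K₀ * (Fintype.card V : ℝ) ^ 6 ≤ K₀ * (Fintype.card V : ℝ) ^ 7 := by gcongr
    have h4 : 1 ≤ (Fintype.card V : ℝ) ^ 7 := one_le_pow₀ hn1
    have : (3 : ℝ) * T₀ ≤ t := by linarith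
    exact_mod_cast this
  rcases le_total Δ σ with h | h
  · rw [min_eq_right h]
    linarith [hthree t ht3 Δ h α₀ (hAmem.2 hα₀) hd]
  · rw [min_eq_left h]
    have := progress_of_le hTne hAconv (hAmem.2 hαs) hσ.le (hthree t ht3 σ le_rfl) h
      (hAmem.2 hα₀) hd
    linarith
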